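/- All graphs are finite and simple. For a graph $G$ let $\delta(G)$ be its minimum degree and $\alpha(G)$ its independence number. For an integer $k\ge 0$, $G$ is $k$-connected if $|V(G)|>k$ and $G-X$ is connected for every $X\subset V(G)$ with $|X|<k$; $G$ is $(K_2\cup kK_1)$-free if it has no induced subgraph isomorphic to the disjoint union of one edge and $k$ isolated vertices. For $S\subset V(G)$ let $\omega(G-S)$ be the number of components of $G-S$; the toughness of $G$ is $t(G)=\min\{|S|/\omega(G-S) : S\subset V(G),\ \omega(G-S)\ge 2\}$ (and $t(G)=\infty$ if $G$ is complete), and $G$ is $t$-tough if $t(G)\ge t$. $G$ is hamiltonian if it has a cycle through all of its vertices. **Theorem.** Let $G$ be a graph. 1. Let $k\ge 2$ be an integer. If $G$ is $k$-connected and $(K_2\cup kK_1)$-free, $\delta(G)\ge \frac{3(k-1)}{2}$ and $\alpha(G)\le \frac{|V(G)|}{2}$, then $G$ is hamiltonian or $G$ is isomorphic to the Petersen graph. 2. Let $k\ge 2$ be an integer. If $G$ is $k$-connected and $(K_2\cup kK_1)$-free, then $\alpha(G)\le\frac{|V(G)|}{2}$ if and only if $G$ is $1$-tough. 3. (Shi–Shan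 conjecture.) Let $k\ge 4$ be an integer. If $G$ is $1$-tough, $2k$-connected and $(K_2\cup kK_1)$-free, then $G$ is hamiltonian. 4. If $|V(G)|\ge 3$ and $G$ is $1$-tough and $(K_2\cup 2K_1)$-free, then $G$ is hamiltonian. 5. If $|V(G)|\ge 3$ and $G$ is $3$-tough and $(K_2\cup 3K_1)$-free, then $G$ is hamiltonian. -/

import Mathlib

open scoped NNReal ENNReal

namespace SimpleGraph

/-- `G` is `k`-connected: it has more than `k` vertices, and deleting fewer than `k` vertices
always leaves a connected graph. -/
def IsKConnected {V : Type*} [Fintype V] (G : SimpleGraph V) (k : ℕ) : Prop :=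
  k < Fintype.card V ∧
    ∀ X : Finset V, X.card < k → (G.induce {v | v ∉ X}).Connected

/-- `K₂ ∪ kK₁`: the disjoint union of one edge and `k` isolated vertices. -/
def edgeUnionIsolated (k : ℕ) : SimpleGraph (Fin 2 ⊕ Fin k) :=
  (⊤ : SimpleGraph (Fin 2)) ⊕g (⊥ : SimpleGraph (Fin k))

/-- `G` is `R`-free: it contains no induced subgraph isomorphic to `R`. -/
def IsInducedFree {V W : Type*} (G : SimpleGraph V) (R : SimpleGraph W) : Prop :=
  ¬ R.IsIndContained G

/-- `ω(G - S)`: the number of connected components of `G` after deleting the vertex set `S`. -/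
noncomputable def numComponentsDelete {V : Type*} (G : SimpleGraph V) (S : Finset V) : ℕ :=
  Nat.card (G.induce {v | v ∉ S}).ConnectedComponent

/-- The toughness of `G`: the minimum of `|S| / ω(G - S)` over all vertex sets `S` with
`ω(G - S) ≥ 2`. For complete graphs there is no such `S`, and the value is `∞`. -/
noncomputable def toughness {V : Type*} (G : SimpleGraph V) : ℝ≥0∞ :=
  ⨅ (S : Finset V) (_ : 2 ≤ G.numComponentsDelete S),
    (S.card : ℝ≥0∞) / (G.numComponentsDelete S : ℝ≥0∞)

/-- `G` is `t`-tough if its toughness is at least `t`. -/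
def IsTough {V : Type*} (G : SimpleGraph V) (t : ℝ≥0) : Prop :=
  (t : ℝ≥0∞) ≤ G.toughness

/-- The Petersen graph: its vertices are the 2-element subsets of a 5-element set, and two of
them are adjacent exactly when they are disjoint. -/
def petersenGraph : SimpleGraph {s : Finset (Fin 5) // s.card = 2} where
  Adj s t := Disjoint s.1 t.1
  symm := ⟨fun _ _ h => Disjoint.symm h⟩
  loopless := ⟨fun s h => by
    have h0 : s.1 = ∅ := Finset.disjoint_self_iff_empty _ |>.mp h
    have h2 := s.2
    simp [h0] at h2⟩

end SimpleGraph

/-! Put m = k - 1. The forbidden subgraph enters only through `EdgeBound`: an independent set with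
no neighbour on some edge has at most m vertices. Suppose G is not hamiltonian and let C be a
longest cycle. The complement of C is independent (`IsLongest.off_indep`): otherwise a component of
G - C containing an edge attaches to C in at most m places, because the successors of the
attachments are independent and miss that edge, and this contradicts (m+1)-connectivity.

So a vertex x off C has all its d ≥ 3m/2 neighbours ("contacts") on C. Call a vertex free if it is
adjacent neither to x nor to any successor of a contact. Since d > m, free vertices are pairwise
nonadjacent (`freeAt_indep`), while a non-free vertex not adjacent to x sees at least d + 1 - m of
the successors (`card_sideNbrs`). Vertices off C are free, so if every edge of C had a free end,
more than half of all vertices would be free. Hence α ≤ |V|/2 yields an edge of C with two non-free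
ends.

Around such an edge, exchange arguments order the contacts: those whose successors are seen from one
end precede those for the other (`lt_of_mem_sideNbrs`). Counting contacts then shows that some
contact has a non-free predecessor, which is impossible for m ≥ 3 and leaves only m = 2, d = 3
(`eq_two`). There, rerouting moves each successor and predecessor of a contact off another longest
cycle, so it has degree 3. This forces contacts at every third place, |C| = 9 and |V| = 10, and the
graph is the Petersen graph (`Exceptional.nonempty_iso`).

The toughness statements follow because t-toughness bounds α and gives connectivity up to 2t, and
connectivity bounds the minimum degree. The Petersen outcome carries k = 3 and a vertex of degree 3,
by which the last three parts exclude it. -/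

namespace SimpleGraph

/-! ### Walks as vertex lists, cycles as periodic maps on ℤ. -/

variable {V : Type*} {G : SimpleGraph V}

/-- `L` lists the vertices of a walk of `G` from `v` to `w`. -/
structure IsSeg (G : SimpleGraph V) (L : List V) (v w : V) : Prop where
  chain : L.IsChain G.Adj
  head : L.head? = some v
  last : L.getLast? = some w

lemma IsSeg.singleton (v : V) : G.IsSeg [v] v v := ⟨by simp, rfl, rfl⟩

lemma IsSeg.ne_nil {L : List V} {v w : V} (h : G.IsSeg L v w) : L ≠ [] := by
  rintro rfl; simpa using h.head

lemma IsSeg.append {L M : List V} {a b c d : V} (h : G.IsSeg L a b) (h' : G.IsSeg M c d)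
    (hbc : G.Adj b c) : G.IsSeg (L ++ M) a d := by
  refine ⟨?_, ?_, ?_⟩
  · rw [List.isChain_append]
    refine ⟨h.chain, h'.chain, fun x hx y hy => ?_⟩
    rw [h.last] at hx; rw [h'.head] at hy
    simp only [Option.mem_def, Option.some.injEq] at hx hy
    subst hx hy; exact hbc
  · rw [List.head?_append, h.head]; rfl
  · rw [List.getLast?_append, h'.last]; rfl

lemma IsSeg.reverse {L : List V} {a b : V} (h : G.IsSeg L a b) : G.IsSeg L.reverse b a := by
  refine ⟨?_, by rw [List.head?_reverse, h.last], by rw [List.getLast?_reverse, h.head]⟩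
  rw [List.isChain_reverse]
  exact h.chain.imp fun _ _ h => h.symm

lemma IsSeg.cons {L : List V} {x a b : V} (h : G.IsSeg L a b) (hx : G.Adj x a) :
    G.IsSeg (x :: L) x b := (IsSeg.singleton x).append h hx

/-- The list `f a, f (a + 1), …, f b`. -/
def seg (f : ℤ → V) (a b : ℤ) : List V :=
  (List.range (b + 1 - a).toNat).map fun k : ℕ => f (a + k)

lemma mem_seg {f : ℤ → V} {a b : ℤ} {v : V} :
    v ∈ seg f a b ↔ ∃ i, a ≤ i ∧ i ≤ b ∧ f i = v := by
  simp only [seg, List.mem_map, List.mem_range]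
  constructor
  · rintro ⟨k, hk, rfl⟩
    exact ⟨a + k, by omega, by omega, rfl⟩
  · rintro ⟨i, hi, hi', rfl⟩
    refine ⟨(i - a).toNat, by omega, ?_⟩
    congr 1; omega

lemma length_seg (f : ℤ → V) (a b : ℤ) : (seg f a b).length = (b + 1 - a).toNat := by
  simp [seg]

lemma seg_self (f : ℤ → V) (a : ℤ) : seg f a a = [f a] := by
  simp [seg]

lemma seg_succ_right (f : ℤ → V) {a b : ℤ} (h : a ≤ b + 1) :
    seg f a (b + 1) = seg f a b ++ [f (b + 1)] := by
  have : (b + 1 + 1 - a).toNat = (b + 1 - a).toNat + 1 := by omega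
  rw [seg, this, List.range_succ, List.map_append, seg]
  have : a + ((b + 1 - a).toNat : ℤ) = b + 1 := by omega
  rw [List.map_singleton, this]

lemma seg_append (f : ℤ → V) {a b c : ℤ} (h : a ≤ b + 1) (h' : b ≤ c) :
    seg f a b ++ seg f (b + 1) c = seg f a c := by
  induction c, h' using Int.leInduction with
  | base =>
    simp [seg]
  | succ n hn ih =>
    rw [seg_succ_right f (by omega), ← List.append_assoc, ih, seg_succ_right f (by omega)]

lemma isSeg_seg {f : ℤ → V} (hf : ∀ i, G.Adj (f i) (f (i + 1))) {a b : ℤ} (h : a ≤ b) :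
    G.IsSeg (seg f a b) (f a) (f b) := by
  induction b, h using Int.leInduction with
  | base => rw [seg_self]; exact IsSeg.singleton _
  | succ n hn ih =>
    rw [seg_succ_right f (by omega)]
    exact ih.append (IsSeg.singleton _) (hf n)

/-- `f` runs periodically around a cycle of `G` with `N` vertices. -/
structure IsCyc (G : SimpleGraph V) (N : ℕ) (f : ℤ → V) : Prop where
  three_le : 3 ≤ N
  adj : ∀ i, G.Adj (f i) (f (i + 1))
  eq_iff : ∀ i j, f i = f j ↔ (N : ℤ) ∣ i - j

/-- Rotation and reversal are mere reparametrisations, so later arguments can be written for the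
edge from `f (N - 1)` to `f 0` and then transported. -/
lemma IsCyc.shift {N : ℕ} {f : ℤ → V} (h : G.IsCyc N f) (k : ℤ) :
    G.IsCyc N (fun i => f (i + k)) := by
  refine ⟨h.three_le, fun i => ?_, fun i j => ?_⟩
  · have := h.adj (i + k)
    rwa [show i + k + 1 = i + 1 + k by ring] at this
  · rw [h.eq_iff, show i + k - (j + k) = i - j by ring]

lemma IsCyc.neg {N : ℕ} {f : ℤ → V} (h : G.IsCyc N f) : G.IsCyc N (fun i => f (-i)) := by
  refine ⟨h.three_le, fun i => ?_, fun i j => ?_⟩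
  · have := h.adj (-(i + 1))
    rw [show -(i + 1) + 1 = -i by ring] at this
    exact this.symm
  · rw [h.eq_iff, show -i - -j = -(i - j) by ring, dvd_neg]

lemma IsCyc.eq_of {N : ℕ} {f : ℤ → V} (h : G.IsCyc N f) {i j : ℤ}
    (hi : i = j ∨ i = j + N ∨ j = i + N) :
    f i = f j := by
  rw [h.eq_iff]
  rcases hi with rfl | rfl | rfl <;> simp

lemma IsCyc.ne_of {N : ℕ} {f : ℤ → V} (h : G.IsCyc N f) {i j : ℤ} (hi : i < j) (hj : j < i + N) :
    f i ≠ f j := by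
  rw [Ne, h.eq_iff]
  intro hd
  have := Int.le_of_dvd (a := N) (b := j - i) (by omega) (by rw [← dvd_neg]; simpa using hd)
  omega

/-- Agreement at every offset `c`, not only at 0, moves the successor and predecessor of a position
along with it. -/
lemma IsCyc.exists_mem_Ico {N : ℕ} {f : ℤ → V} (h : G.IsCyc N f) (a t : ℤ) :
    ∃ t', a ≤ t' ∧ t' < a + N ∧ ∀ c, f (t' + c) = f (t + c) := by
  have hN : (0 : ℤ) < N := by have := h.three_le; omega
  refine ⟨a + (t - a) % N, ?_, ?_, fun c => ?_⟩
  · have := Int.emod_nonneg (t - a) hN.ne'; omega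
  · have := Int.emod_lt_of_pos (t - a) hN; omega
  · rw [h.eq_iff]
    have := Int.emod_add_mul_ediv (t - a) N
    exact ⟨-((t - a) / N), by linarith⟩

lemma IsCyc.nodup_seg {N : ℕ} {f : ℤ → V} (h : G.IsCyc N f) {a b : ℤ} (hb : b < a + N) :
    (seg f a b).Nodup := by
  refine List.Nodup.map_on ?_ List.nodup_range
  intro x hx y hy hxy
  rw [List.mem_range] at hx hy
  rcases lt_trichotomy x y with hlt | rfl | hlt
  · exact absurd hxy (h.ne_of (by omega) (by omega))
  · rfl
  · exact absurd hxy.symm (h.ne_of (by omega) (by omega))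

/-- A closed walk listed without repetition gives a cycle. -/
lemma IsSeg.exists_isCyc {L : List V} {v w : V} (h : G.IsSeg L v w) (hwv : G.Adj w v)
    (hL : L.Nodup) (h3 : 3 ≤ L.length) :
    ∃ f : ℤ → V, G.IsCyc L.length f ∧ ∀ u, u ∈ L ↔ ∃ i, f i = u := by
  have hpos : (0 : ℤ) < L.length := by omega
  have hmod (i : ℤ) : (i % L.length).toNat < L.length := by
    have := Int.emod_nonneg i hpos.ne'
    have := Int.emod_lt_of_pos i hpos
    omega
  have hget (i : ℕ) (hi : i < L.length) : L[((i : ℤ) % L.length).toNat]'(hmod i) = L[i] := by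
    congr 1
    rw [Int.emod_eq_of_lt (by omega) (by omega)]; simp
  refine ⟨fun i => L[(i % L.length).toNat]'(hmod i), ⟨h3, fun i => ?_, fun i j => ?_⟩, ?_⟩
  · have h0 := Int.emod_nonneg i hpos.ne'
    have h1 := Int.emod_lt_of_pos i hpos
    by_cases hi : i % L.length + 1 < L.length
    · have : ((i + 1) % L.length).toNat = (i % L.length).toNat + 1 := by
        rw [Int.add_emod, Int.emod_eq_of_lt (a := 1) (by omega) (by omega),
          Int.emod_eq_of_lt (by omega) hi]
        omega
      simp only [this]
      exact List.isChain_iff_getElem.1 h.chain _ (by omega)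
    -- The wrap-around from the last entry to the first; the closing edge `hwv` is used here.
    · have hlast : (i % L.length).toNat = L.length - 1 := by omega
      have hz : ((i + 1) % L.length).toNat = 0 := by
        rw [Int.add_emod, Int.emod_eq_of_lt (a := 1) (by omega) (by omega),
          show i % (L.length : ℤ) + 1 = L.length by omega]
        simp
      simp only [hlast, hz]
      have hh := h.head
      have hl := h.last
      rw [List.head?_eq_getElem?, List.getElem?_eq_some_iff] at hh
      rw [List.getLast?_eq_getElem?, List.getElem?_eq_some_iff] at hl
      obtain ⟨_, hh⟩ := hh
      obtain ⟨_, hl⟩ := hl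
      rw [hh, hl]
      exact hwv
  · rw [hL.getElem_inj_iff]
    have h0 := Int.emod_nonneg i hpos.ne'
    have h1 := Int.emod_nonneg j hpos.ne'
    rw [Int.dvd_iff_emod_eq_zero, ← Int.emod_eq_emod_iff_emod_sub_eq_zero]
    omega
  · intro u
    constructor
    · intro hu
      obtain ⟨i, hi, rfl⟩ := List.getElem_of_mem hu
      exact ⟨i, hget i hi⟩
    · rintro ⟨i, rfl⟩
      exact List.getElem_mem _

lemma IsCyc.isHamiltonian [Fintype V] [DecidableEq V] {N : ℕ} {f : ℤ → V} (h : G.IsCyc N f)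
    (hN : N = Fintype.card V) : G.IsHamiltonian := by
  intro _
  have h3 := h.three_le
  have hs : G.IsSeg (seg f 1 N) (f 1) (f N) := isSeg_seg h.adj (by omega)
  have hnd : (seg f 1 N).Nodup := h.nodup_seg (by omega)
  obtain ⟨L, hL⟩ : ∃ L, seg f 1 N = L := ⟨_, rfl⟩
  rw [hL] at hs hnd
  have hlen : L.length = Fintype.card V := by rw [← hL, length_seg]; omega
  have hfull : ∀ a, L.count a = 1 := by
    intro a
    refine List.count_eq_one_of_mem hnd ?_
    have hc : L.toFinset.card = Fintype.card V := by rw [List.toFinset_card_of_nodup hnd, hlen]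
    have := (Finset.card_eq_iff_eq_univ _).1 hc
    rw [← List.mem_toFinset, this]; exact Finset.mem_univ a
  have hne : f N :: L ≠ [] := List.cons_ne_nil _ _
  have hadj : G.Adj (f N) (f 1) := by
    have := h.adj N
    rwa [h.eq_of (i := N + 1) (j := 1) (by omega)] at this
  obtain ⟨p, hp⟩ : ∃ p : G.Walk (f N) (f N), p.support = f N :: L := by
    have hseg := hs.cons hadj
    refine ⟨(Walk.ofSupport _ hne hseg.chain).copy ?_ ?_, ?_⟩
    · exact List.head_cons
    · have := hseg.last
      rw [List.getLast?_eq_some_getLast hne] at this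
      simpa using this
    · rw [Walk.support_copy, Walk.support_ofSupport]
  refine ⟨f N, p, ?_⟩
  rw [Walk.isHamiltonianCycle_iff_isCycle_and_support_count_tail_eq_one]
  refine ⟨?_, fun a => by rw [hp]; exact hfull a⟩
  have hpl : p.length = Fintype.card V := by
    have := p.length_support
    rw [hp, List.length_cons, hlen] at this
    omega
  rw [Walk.isCycle_iff_isPath_tail_and_le_length, Walk.isPath_def,
    Walk.support_tail_of_not_nil _ (by rw [Walk.not_nil_iff_lt_length]; omega), hp]
  exact ⟨hnd, by omega⟩

end SimpleGraph

/-! ### Exchange arguments around a vertex off a longest cycle. -/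

namespace SimpleGraph

variable {V : Type*} {G : SimpleGraph V}

/-- `f` runs around a longest cycle of `G`, with `N` vertices. -/
structure IsLongest (G : SimpleGraph V) (N : ℕ) (f : ℤ → V) : Prop extends G.IsCyc N f where
  le : ∀ M g, G.IsCyc M g → M ≤ N

lemma seg_append' (f : ℤ → V) {a b c : ℤ} (h : a ≤ b) (h' : b ≤ c + 1) :
    seg f a (b - 1) ++ seg f b c = seg f a c := by
  have := seg_append f (a := a) (b := b - 1) (c := c) (by omega) (by omega)
  rwa [sub_add_cancel] at this

namespace IsLongest

variable {N : ℕ} {f : ℤ → V} {x : V}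

lemma shift (h : G.IsLongest N f) (k : ℤ) : G.IsLongest N (fun i => f (i + k)) :=
  ⟨h.toIsCyc.shift k, h.le⟩

lemma neg (h : G.IsLongest N f) : G.IsLongest N (fun i => f (-i)) := ⟨h.toIsCyc.neg, h.le⟩

lemma length_le (h : G.IsLongest N f) {L : List V} {v w : V} (hL : G.IsSeg L v w)
    (hwv : G.Adj w v) (hnd : L.Nodup) : L.length ≤ N := by
  by_cases h3 : 3 ≤ L.length
  · obtain ⟨g, hg, -⟩ := hL.exists_isCyc hwv hnd h3
    exact h.le _ g hg
  · have := h.three_le; omega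

/-- No cycle passes through all vertices of a longest cycle and through further vertices `E`. -/
lemma not_perm (h : G.IsLongest N f) {L E : List V} {v w : V} (hL : G.IsSeg L v w)
    (hwv : G.Adj w v) {a b : ℤ} (hab : b = a + N - 1) (hp : L.Perm (E ++ seg f a b))
    (hE : E.Nodup) (hEf : ∀ e ∈ E, ∀ i, f i ≠ e) (hne : E ≠ []) : False := by
  have h3 := h.three_le
  -- Both distinctness and length are read off the permutation, so each exchange needs only a
  -- concatenation of segments and a comparison of counts.
  have hnd : L.Nodup := by
    rw [hp.nodup_iff, List.nodup_append]
    refine ⟨hE, h.nodup_seg (by omega), fun e he u hu heu => ?_⟩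
    obtain ⟨i, -, -, rfl⟩ := mem_seg.1 hu
    exact hEf e he i heu.symm
  have h1 := h.length_le hL hwv hnd
  rw [hp.length_eq, List.length_append, length_seg] at h1
  have := List.length_pos_iff.2 hne
  omega

lemma not_perm_cons (h : G.IsLongest N f) (hx : ∀ i, f i ≠ x) {L : List V} {v w : V}
    (hL : G.IsSeg L v w) (hwv : G.Adj w v) {a b : ℤ} (hab : b = a + N - 1)
    (hp : L.Perm (x :: seg f a b)) : False :=
  h.not_perm hL hwv hab (E := [x]) hp (List.nodup_singleton x) (by simpa using hx) (by simp)

lemma adj_period (h : G.IsLongest N f) : G.Adj (f (N - 1)) (f 0) := by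
  have := h.adj (N - 1)
  rwa [h.toIsCyc.eq_of (i := N - 1 + 1) (j := 0) (by omega)] at this

/-- A vertex off a longest cycle has no two consecutive neighbours on it. -/
lemma not_adj_succ (h : G.IsLongest N f) (hx : ∀ i, f i ≠ x) {t : ℤ} (h0 : G.Adj x (f t))
    (h1 : G.Adj x (f (t + 1))) : False := by
  have h3 := h.three_le
  refine h.not_perm_cons hx (a := t + 1) (b := t + N)
    ((isSeg_seg h.adj (by omega)).cons h1) ?_ (by ring) (List.Perm.refl _)
  rw [h.toIsCyc.eq_of (i := t + N) (j := t) (by omega)]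
  exact h0.symm

/-- The longer cycle runs x, `f t'` back to `f (t + 1)`, then `f (t' + 1)` on to `f (t + N) = f t`,
and returns to x. -/
lemma not_adj_succ_succ_aux (h : G.IsLongest N f) (hx : ∀ i, f i ≠ x) {t t' : ℤ}
    (h0 : G.Adj x (f t)) (h1 : G.Adj x (f t')) (htt : t < t') (ht' : t' < t + N)
    (hadj : G.Adj (f (t + 1)) (f (t' + 1))) : False := by
  classical
  have h3 := h.three_le
  refine h.not_perm_cons hx (a := t + 1) (b := t + N)
    (((isSeg_seg h.adj (a := t + 1) (b := t') (by omega)).reverse.append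
      (isSeg_seg h.adj (a := t' + 1) (b := t + N) (by omega)) hadj).cons h1) ?_ (by ring) ?_
  · rw [h.toIsCyc.eq_of (i := t + N) (j := t) (by omega)]
    exact h0.symm
  · rw [← seg_append f (a := t + 1) (b := t') (c := t + N) (by omega) (by omega)]
    simp only [List.perm_iff_count, List.count_append, List.count_cons, List.count_reverse]
    intro; trivial

/-- Successors of neighbours of a vertex off a longest cycle are independent. -/
lemma not_adj_succ_succ (h : G.IsLongest N f) (hx : ∀ i, f i ≠ x) {t t' : ℤ}
    (h0 : G.Adj x (f t)) (h1 : G.Adj x (f t')) : ¬ G.Adj (f (t + 1)) (f (t' + 1)) := by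
  intro hadj
  obtain ⟨s, hs, hs', hst⟩ := h.toIsCyc.exists_mem_Ico t t'
  rw [← hst] at hadj
  rw [← add_zero t', ← hst, add_zero] at h1
  rcases hs.eq_or_lt with rfl | hlt
  · exact hadj.ne rfl
  · exact h.not_adj_succ_succ_aux hx h0 h1 hlt hs' hadj

/-- Two vertices off a longest cycle: one cannot have as neighbours two successors of
neighbours of the other. -/
lemma not_adj_two_succ (h : G.IsLongest N f) (hx : ∀ i, f i ≠ x) {y : V} (hy : ∀ i, f i ≠ y)
    (hyx : y ≠ x) {t t' : ℤ} (htt : t < t') (ht' : t' < t + N)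
    (h0 : G.Adj x (f t)) (h1 : G.Adj x (f t')) (h2 : G.Adj y (f (t + 1)))
    (h3 : G.Adj y (f (t' + 1))) : False := by
  classical
  refine h.not_perm (E := [x, y]) (a := t + 1) (b := t + N)
    (((isSeg_seg h.adj (a := t + 1) (b := t') (by omega)).reverse.append
      ((isSeg_seg h.adj (a := t' + 1) (b := t + N) (by omega)).cons h3) h2.symm).cons h1) ?_ (by ring)
      ?_ (by simpa using hyx.symm) (by simpa using ⟨hx, hy⟩) (by simp)
  · rw [h.toIsCyc.eq_of (i := t + N) (j := t) (by omega)]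
    exact h0.symm
  · rw [← seg_append f (a := t + 1) (b := t') (c := t + N) (by omega) (by omega)]
    simp only [List.perm_iff_count, List.count_append, List.count_cons, List.count_reverse,
      List.count_nil]
    intro; omega

/-- The longer cycle runs `f 0` to `f t`, x, `f t'` back to `f (t + 1)`, `f (N - 1)` back to `f (t'
+ 1)`, then closes at `f 0`. -/
lemma not_crossing (h : G.IsLongest N f) (hx : ∀ i, f i ≠ x) {t t' : ℤ} (ht : 0 ≤ t) (htt : t < t')
    (ht' : t' < N - 1) (h0 : G.Adj x (f t)) (h1 : G.Adj x (f t'))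
    (hp : G.Adj (f (N - 1)) (f (t + 1))) (hs : G.Adj (f 0) (f (t' + 1))) : False := by
  classical
  refine h.not_perm_cons hx (a := 0) (b := N - 1)
    ((isSeg_seg h.adj (a := 0) (b := t) (by omega)).append
      (((isSeg_seg h.adj (a := t + 1) (b := t') (by omega)).reverse.append
        (isSeg_seg h.adj (a := t' + 1) (b := N - 1) (by omega)).reverse hp.symm).cons h1)
      h0.symm) hs.symm (by ring) ?_
  rw [← seg_append f (a := 0) (b := t) (c := N - 1) (by omega) (by omega),
    ← seg_append f (a := t + 1) (b := t') (c := N - 1) (by omega) (by omega)]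
  simp only [List.perm_iff_count, List.count_append, List.count_cons, List.count_reverse]
  intro; omega

/-- The longer cycle runs `f 0` to `f l`, x, `f j` to `f (N - 1)`, `f (j - 1)` back to `f (l + 1)`,
then closes at `f 0`. -/
lemma not_mixed_crossing (h : G.IsLongest N f) (hx : ∀ i, f i ≠ x) {l j : ℤ} (hl : 0 ≤ l)
    (hlj : l < j) (hj : j ≤ N - 1) (h0 : G.Adj x (f l)) (h1 : G.Adj x (f j))
    (hs : G.Adj (f 0) (f (l + 1))) (hp : G.Adj (f (N - 1)) (f (j - 1))) : False := by
  classical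
  have hne : l + 1 ≠ j := by rintro rfl; exact h.not_adj_succ hx h0 h1
  refine h.not_perm_cons hx (a := 0) (b := N - 1)
    ((isSeg_seg h.adj (a := 0) (b := l) (by omega)).append
      (((isSeg_seg h.adj (a := j) (b := N - 1) (by omega)).append
        (isSeg_seg h.adj (a := l + 1) (b := j - 1) (by omega)).reverse hp).cons h1)
      h0.symm) hs.symm (by ring) ?_
  rw [← seg_append f (a := 0) (b := l) (c := N - 1) (by omega) (by omega),
    ← seg_append' f (a := l + 1) (b := j) (c := N - 1) (by omega) (by omega)]
  simp only [List.perm_iff_count, List.count_append, List.count_cons, List.count_reverse]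
  intro; omega

/-- The longer cycle runs x, `f l` to `f (N - 1)`, `f (t + 1)` to `f (l - 1)`, `f 0` to `f t`, then
closes at x. -/
lemma not_adj_pred_of_lt (h : G.IsLongest N f) (hx : ∀ i, f i ≠ x) {t l : ℤ} (ht : 0 ≤ t)
    (htl : t < l) (hl : l ≤ N - 1) (h1 : G.Adj x (f t)) (h2 : G.Adj x (f l))
    (hp : G.Adj (f (N - 1)) (f (t + 1))) (hs : G.Adj (f 0) (f (l - 1))) : False := by
  classical
  have hne : t + 1 ≠ l := by rintro rfl; exact h.not_adj_succ hx h1 h2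
  refine h.not_perm_cons hx (a := 0) (b := N - 1)
    ((((isSeg_seg h.adj (a := l) (b := N - 1) (by omega)).append
      (isSeg_seg h.adj (a := t + 1) (b := l - 1) (by omega)) hp).append
        (isSeg_seg h.adj (a := 0) (b := t) (by omega)) hs.symm).cons h2)
      h1.symm (by ring) ?_
  rw [← seg_append f (a := 0) (b := t) (c := N - 1) (by omega) (by omega),
    ← seg_append' f (a := t + 1) (b := l) (c := N - 1) (by omega) (by omega)]
  simp only [List.perm_iff_count, List.count_append, List.count_cons]
  intro; omega

/-- The longer cycle runs x, `f q` back to `f 1`, `f (t - 1)` back to `f (q + 1)`, `f 0`, `f (N -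
1)` back to `f t`, then closes at x. -/
lemma not_adj_succ_of_lt (h : G.IsLongest N f) (hx : ∀ i, f i ≠ x) {q t : ℤ} (hq : 0 < q)
    (hqt : q < t) (ht : t ≤ N - 1) (h1 : G.Adj x (f q)) (h2 : G.Adj x (f t))
    (hu : G.Adj (f (t - 1)) (f 1)) (hs : G.Adj (f 0) (f (q + 1))) : False := by
  classical
  have hne : q + 1 ≠ t := by rintro rfl; exact h.not_adj_succ hx h1 h2
  refine h.not_perm_cons hx (a := 0) (b := N - 1)
    (((((isSeg_seg h.adj (a := 1) (b := q) (by omega)).reverse.append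
      (isSeg_seg h.adj (a := q + 1) (b := t - 1) (by omega)).reverse hu.symm).append
        (isSeg_seg h.adj (a := 0) (b := 0) (by omega)) hs.symm).append
        (isSeg_seg h.adj (a := t) (b := N - 1) (by omega)).reverse h.adj_period.symm).cons h1)
      h2.symm (by ring) ?_
  rw [← seg_append f (a := 0) (b := 0) (c := N - 1) (by omega) (by omega),
    ← seg_append f (a := 0 + 1) (b := q) (c := N - 1) (by omega) (by omega),
    ← seg_append' f (a := q + 1) (b := t) (c := N - 1) (by omega) (by omega)]
  simp only [List.perm_iff_count, List.count_append, List.count_cons, List.count_reverse, zero_add]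
  intro; omega

/-- Rerouting a longest cycle through `x`, keeping its ends `f 0`, `f (N - 1)` and avoiding the
successor of a neighbour of `x`. -/
lemma exists_reroute (h : G.IsLongest N f) {t t' : ℤ} (ht : 0 ≤ t)
    (htN : t + 2 ≤ N - 1) (ht0 : 0 ≤ t') (htN' : t' + 1 ≤ N - 1) (hne : t ≠ t')
    (hne' : t' ≠ t + 1) (h0 : G.Adj x (f t))
    (h1 : G.Adj x (f t')) (hw : G.Adj (f (t + 2)) (f (t' + 1))) :
    ∃ L, G.IsSeg L (f 0) (f (N - 1)) ∧ (f (t + 1) :: L).Perm (x :: seg f 0 (N - 1)) := by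
  classical
  rcases lt_or_gt_of_ne hne with hlt | hlt
  · refine ⟨_, (isSeg_seg h.adj (a := 0) (b := t) (by omega)).append
      (((isSeg_seg h.adj (a := t + 2) (b := t') (by omega)).reverse.append
        (isSeg_seg h.adj (a := t' + 1) (b := N - 1) (by omega)) hw).cons h1) h0.symm, ?_⟩
    rw [← seg_append f (a := 0) (b := t) (c := N - 1) (by omega) (by omega),
      ← seg_append f (a := t + 1) (b := t + 1) (c := N - 1) (by omega) (by omega), seg_self,
      show t + 1 + 1 = t + 2 by ring,
      ← seg_append f (a := t + 2) (b := t') (c := N - 1) (by omega) (by omega)]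
    simp only [List.perm_iff_count, List.count_append, List.count_cons, List.count_reverse,
      List.count_nil]
    intro; omega
  · refine ⟨_, (isSeg_seg h.adj (a := 0) (b := t') (by omega)).append
      (((isSeg_seg h.adj (a := t' + 1) (b := t) (by omega)).reverse.append
        (isSeg_seg h.adj (a := t + 2) (b := N - 1) (by omega)) hw.symm).cons h0) h1.symm, ?_⟩
    rw [← seg_append f (a := 0) (b := t') (c := N - 1) (by omega) (by omega),
      ← seg_append f (a := t' + 1) (b := t) (c := N - 1) (by omega) (by omega),
      ← seg_append f (a := t + 1) (b := t + 1) (c := N - 1) (by omega) (by omega), seg_self,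
      show t + 1 + 1 = t + 2 by ring]
    simp only [List.perm_iff_count, List.count_append, List.count_cons, List.count_reverse,
      List.count_nil]
    intro; omega

lemma exists_reroute_of_adj (h : G.IsLongest N f) {t : ℤ} (ht : 0 ≤ t)
    (htN : t + 2 ≤ N - 1) (h0 : G.Adj x (f t)) (h1 : G.Adj x (f (t + 2))) :
    ∃ L, G.IsSeg L (f 0) (f (N - 1)) ∧ (f (t + 1) :: L).Perm (x :: seg f 0 (N - 1)) := by
  classical
  refine ⟨_, (isSeg_seg h.adj (a := 0) (b := t) (by omega)).append
      ((isSeg_seg h.adj (a := t + 2) (b := N - 1) (by omega)).cons h1) h0.symm, ?_⟩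
  rw [← seg_append f (a := 0) (b := t) (c := N - 1) (by omega) (by omega),
      ← seg_append f (a := t + 1) (b := t + 1) (c := N - 1) (by omega) (by omega), seg_self,
      show t + 1 + 1 = t + 2 by ring]
  simp only [List.perm_iff_count, List.count_append, List.count_cons,
      List.count_nil]
  intro; omega

/-- A vertex inserted between the ends of a rerouted cycle. -/
lemma not_reroute (h : G.IsLongest N f) (hx : ∀ i, f i ≠ x) {u : V} {L : List V}
    (hL : G.IsSeg L (f 0) (f (N - 1))) (hp : (u :: L).Perm (x :: seg f 0 (N - 1)))
    (hu0 : G.Adj u (f 0)) (hu1 : G.Adj u (f (N - 1))) : False :=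
  h.not_perm_cons hx (hL.cons hu0) hu1.symm (by ring) hp

end IsLongest

end SimpleGraph

/-! ### Contacts, free vertices and the basic counts. -/

namespace SimpleGraph

variable {V : Type*} {G : SimpleGraph V}

/-- An edge of `G` together with an independent set without neighbours on this edge: such a set
has at most `m` elements. -/
def EdgeBound (G : SimpleGraph V) (m : ℕ) : Prop :=
  ∀ y z, G.Adj y z → ∀ S : Finset V, (∀ a ∈ S, ∀ b ∈ S, ¬ G.Adj a b) →
    (∀ s ∈ S, ¬ G.Adj y s ∧ ¬ G.Adj z s) → S.card ≤ m

/-- A longest cycle `f` whose complement is independent, and a vertex `x` off `f` whose degree is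
at least `3m/2`, in a graph satisfying `EdgeBound`. -/
structure Bypassed (G : SimpleGraph V) (m N : ℕ) (f : ℤ → V) (x : V) : Prop where
  longest : G.IsLongest N f
  off : ∀ i, f i ≠ x
  off_indep : ∀ y z, (∀ i, f i ≠ y) → (∀ i, f i ≠ z) → ¬ G.Adj y z
  edge : G.EdgeBound m
  one_le : 1 ≤ m
  deg : 3 * m ≤ 2 * (G.neighborSet x).ncard

open Classical in
/-- The positions in `[0, N)` of the neighbours of `x` on `f`. -/
noncomputable def contacts (G : SimpleGraph V) (N : ℕ) (f : ℤ → V) (x : V) : Finset ℤ :=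
  (Finset.Ico (0 : ℤ) N).filter fun t => G.Adj x (f t)

open Classical in
/-- The contacts `t` such that `v` is adjacent to `f (t + e)`. -/
noncomputable def sideNbrs (G : SimpleGraph V) (N : ℕ) (f : ℤ → V) (x : V) (e : ℤ) (v : V) :
    Finset ℤ :=
  (G.contacts N f x).filter fun t => G.Adj v (f (t + e))

/-- `v` is adjacent neither to `x` nor to any `f (t + e)` for which `f t` is adjacent to `x`. -/
def FreeAt (G : SimpleGraph V) (f : ℤ → V) (x : V) (e : ℤ) (v : V) : Prop :=
  ¬ G.Adj v x ∧ ∀ t, G.Adj x (f t) → ¬ G.Adj v (f (t + e))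

variable {m N : ℕ} {f : ℤ → V} {x v w : V} {e t : ℤ}

lemma mem_contacts : t ∈ G.contacts N f x ↔ (0 ≤ t ∧ t < N) ∧ G.Adj x (f t) := by
  simp [contacts]

lemma mem_sideNbrs : t ∈ G.sideNbrs N f x e v ↔ t ∈ G.contacts N f x ∧ G.Adj v (f (t + e)) := by
  classical
  unfold sideNbrs
  exact Finset.mem_filter

lemma sideNbrs_subset : G.sideNbrs N f x e v ⊆ G.contacts N f x :=
  fun _ h => (mem_sideNbrs.1 h).1

namespace Bypassed

lemma shift (h : G.Bypassed m N f x) (k : ℤ) : G.Bypassed m N (fun i => f (i + k)) x where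
  longest := h.longest.shift k
  off i := h.off _
  off_indep y z hy hz := h.off_indep y z (fun i => by simpa using hy (i - k))
    (fun i => by simpa using hz (i - k))
  edge := h.edge
  one_le := h.one_le
  deg := h.deg

lemma freeAt_shift (k : ℤ) :
    G.FreeAt (fun i => f (i + k)) x e v ↔ G.FreeAt f x e v := by
  refine and_congr_right fun _ => ⟨fun H t ht => ?_, fun H t ht => ?_⟩
  · have : ¬ G.Adj v (f (t - k + e + k)) := H (t - k) (by simpa using ht)
    rwa [show t - k + e + k = t + e by ring] at this
  · have := H (t + k) ht
    change ¬ G.Adj v (f (t + e + k))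
    rwa [show t + k + e = t + e + k by ring] at this

lemma card_contacts (h : G.Bypassed m N f x) :
    (G.contacts N f x).card = (G.neighborSet x).ncard := by
  rw [← Set.ncard_coe_finset]
  refine Set.ncard_congr (fun t _ => f t) (fun t ht => (mem_contacts.1 ht).2) ?_ ?_
  · intro s t hs ht hst
    have hs := (mem_contacts.1 hs).1
    have ht := (mem_contacts.1 ht).1
    rcases lt_trichotomy s t with hlt | rfl | hlt
    · exact absurd hst (h.longest.toIsCyc.ne_of hlt (by omega))
    · rfl
    · exact absurd hst.symm (h.longest.toIsCyc.ne_of hlt (by omega))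
  · intro v hv
    by_contra hcon
    refine h.off_indep x v h.off (fun i hi => hcon ?_) hv
    obtain ⟨t, h0, h1, ht⟩ := h.longest.toIsCyc.exists_mem_Ico 0 i
    have ht := ht 0
    rw [add_zero, add_zero, hi] at ht
    exact ⟨t, mem_contacts.2 ⟨⟨h0, by omega⟩, by rw [ht]; exact hv⟩, ht⟩

lemma not_adj_side (h : G.Bypassed m N f x) (he : e = 1 ∨ e = -1) (ht : G.Adj x (f t)) :
    ¬ G.Adj x (f (t + e)) := by
  intro h1
  rcases he with rfl | rfl
  · exact h.longest.not_adj_succ h.off ht h1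
  · exact h.longest.not_adj_succ h.off h1 (by simpa using ht)

lemma not_adj_side_side (h : G.Bypassed m N f x) (he : e = 1 ∨ e = -1) {s : ℤ}
    (ht : G.Adj x (f t)) (hs : G.Adj x (f s)) : ¬ G.Adj (f (t + e)) (f (s + e)) := by
  rcases he with rfl | rfl
  · exact h.longest.not_adj_succ_succ h.off ht hs
  · have := h.longest.neg.not_adj_succ_succ (t := -t) (t' := -s) (fun i => h.off (-i))
      (by simpa using ht) (by simpa using hs)
    simpa [add_comm, sub_eq_add_neg] using this

lemma freeAt_side (h : G.Bypassed m N f x) (he : e = 1 ∨ e = -1) (ht : G.Adj x (f t)) :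
    G.FreeAt f x e (f (t + e)) :=
  ⟨fun h' => h.not_adj_side he ht h'.symm, fun _ hs => h.not_adj_side_side he ht hs⟩

lemma side_injOn (h : G.Bypassed m N f x) (e : ℤ) :
    Set.InjOn (fun t => f (t + e)) (G.contacts N f x) := by
  intro s hs t ht hst
  have hs := (mem_contacts.1 hs).1
  have ht := (mem_contacts.1 ht).1
  rcases lt_trichotomy s t with hlt | rfl | hlt
  · exact absurd hst (h.longest.toIsCyc.ne_of (by omega) (by omega))
  · rfl
  · exact absurd hst.symm (h.longest.toIsCyc.ne_of (by omega) (by omega))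

lemma exists_contact (h : G.Bypassed m N f x) (ht : G.Adj x (f t)) :
    ∃ s ∈ G.contacts N f x, ∀ c, f (s + c) = f (t + c) := by
  obtain ⟨s, h0, h1, hs⟩ := h.longest.toIsCyc.exists_mem_Ico 0 t
  refine ⟨s, mem_contacts.2 ⟨⟨h0, by omega⟩, ?_⟩, hs⟩
  rw [← add_zero s, hs, add_zero]; exact ht

-- Let `v` be adjacent to one side vertex `f (t + e)`. The side vertices that `v` misses, together
-- with x, are independent and avoid both ends of this edge, so `EdgeBound` allows at most m - 1
-- missed ones.
open Classical in
lemma card_sideNbrs (h : G.Bypassed m N f x) (he : e = 1 ∨ e = -1) (hv : ¬ G.FreeAt f x e v)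
    (hvx : ¬ G.Adj v x) :
    (G.neighborSet x).ncard + 1 ≤ (G.sideNbrs N f x e v).card + m := by
  simp only [FreeAt, hvx, not_false_eq_true, true_and, not_forall, not_not] at hv
  obtain ⟨t, ht, hvt⟩ := hv
  set B := (G.contacts N f x).filter fun s => ¬ G.Adj v (f (s + e)) with hB
  have hcard : (G.sideNbrs N f x e v).card + B.card = (G.neighborSet x).ncard := by
    rw [← h.card_contacts]
    exact Finset.card_filter_add_card_filter_not _
  have hx : x ∉ B.image fun s => f (s + e) := by
    simp only [Finset.mem_image, not_exists, not_and]
    exact fun s _ => h.off _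
  have hBm : ∀ s ∈ B, G.Adj x (f s) ∧ ¬ G.Adj v (f (s + e)) := by
    intro s hs
    rw [hB, Finset.mem_filter] at hs
    exact ⟨(mem_contacts.1 hs.1).2, hs.2⟩
  have hbound := h.edge v (f (t + e)) hvt (insert x (B.image fun s => f (s + e))) ?_ ?_
  · rw [Finset.card_insert_of_notMem hx, Finset.card_image_of_injOn] at hbound
    · omega
    · exact (h.side_injOn e).mono (Finset.coe_subset.2 (Finset.filter_subset _ _))
  · intro a ha b hb
    simp only [Finset.mem_insert, Finset.mem_image] at ha hb
    rcases ha with rfl | ⟨s, hs, rfl⟩ <;> rcases hb with rfl | ⟨r, hr, rfl⟩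
    · exact G.loopless.irrefl _
    · exact h.not_adj_side he (hBm r hr).1
    · exact fun h' => h.not_adj_side he (hBm s hs).1 h'.symm
    · exact h.not_adj_side_side he (hBm s hs).1 (hBm r hr).1
  · intro a ha
    simp only [Finset.mem_insert, Finset.mem_image] at ha
    rcases ha with rfl | ⟨s, hs, rfl⟩
    · exact ⟨hvx, fun h' => h.not_adj_side he ht h'.symm⟩
    · exact ⟨(hBm s hs).2, h.not_adj_side_side he ht (hBm s hs).1⟩

-- The edge is now `v x`, so x no longer joins the independent set and the bound is weaker by one.
open Classical in
lemma card_sideNbrs_of_adj (h : G.Bypassed m N f x) (he : e = 1 ∨ e = -1) (hvx : G.Adj v x) :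
    (G.neighborSet x).ncard ≤ (G.sideNbrs N f x e v).card + m := by
  set B := (G.contacts N f x).filter fun s => ¬ G.Adj v (f (s + e)) with hB
  have hcard : (G.sideNbrs N f x e v).card + B.card = (G.neighborSet x).ncard := by
    rw [← h.card_contacts]
    exact Finset.card_filter_add_card_filter_not _
  have hBm : ∀ s ∈ B, G.Adj x (f s) ∧ ¬ G.Adj v (f (s + e)) := by
    intro s hs
    rw [hB, Finset.mem_filter] at hs
    exact ⟨(mem_contacts.1 hs.1).2, hs.2⟩
  have hbound := h.edge v x hvx (B.image fun s => f (s + e)) ?_ ?_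
  · rw [Finset.card_image_of_injOn] at hbound
    · omega
    · exact (h.side_injOn e).mono (Finset.coe_subset.2 (Finset.filter_subset _ _))
  · intro a ha b hb
    simp only [Finset.mem_image] at ha hb
    obtain ⟨s, hs, rfl⟩ := ha
    obtain ⟨r, hr, rfl⟩ := hb
    exact h.not_adj_side_side he (hBm s hs).1 (hBm r hr).1
  · intro a ha
    simp only [Finset.mem_image] at ha
    obtain ⟨s, hs, rfl⟩ := ha
    exact ⟨(hBm s hs).2, h.not_adj_side he (hBm s hs).1⟩

open Classical in
/-- The vertices that are `FreeAt` form an independent set. -/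
lemma freeAt_indep (h : G.Bypassed m N f x) (he : e = 1 ∨ e = -1) (hv : G.FreeAt f x e v)
    (hw : G.FreeAt f x e w) : ¬ G.Adj v w := by
  intro hvw
  -- All d successors would avoid the edge `v w`, although d > m.
  have hbound := h.edge v w hvw ((G.contacts N f x).image fun s => f (s + e)) ?_ ?_
  · rw [Finset.card_image_of_injOn (h.side_injOn e), h.card_contacts] at hbound
    have := h.deg
    have := h.one_le
    omega
  · intro a ha b hb
    simp only [Finset.mem_image] at ha hb
    obtain ⟨s, hs, rfl⟩ := ha
    obtain ⟨r, hr, rfl⟩ := hb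
    exact h.not_adj_side_side he (mem_contacts.1 hs).2 (mem_contacts.1 hr).2
  · intro a ha
    simp only [Finset.mem_image] at ha
    obtain ⟨s, hs, rfl⟩ := ha
    exact ⟨hv.2 s (mem_contacts.1 hs).2, hw.2 s (mem_contacts.1 hs).2⟩

lemma freeAt_self (h : G.Bypassed m N f x) (he : e = 1 ∨ e = -1) : G.FreeAt f x e x :=
  ⟨G.loopless.irrefl _, fun _ ht => h.not_adj_side he ht⟩

/-- All vertices off the cycle are free. -/
lemma freeAt_of_off (h : G.Bypassed m N f x) {y : V} (hy : ∀ i, f i ≠ y) : G.FreeAt f x 1 y := by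
  by_cases hyx : y = x
  · subst hyx; exact h.freeAt_self (Or.inl rfl)
  by_contra hcon
  have hnot := h.off_indep y x hy h.off
  have hc := h.card_sideNbrs (Or.inl rfl) hcon hnot
  have hd := h.deg
  have h1 := h.one_le
  -- Here d + 1 - m ≥ 2, so `y` sees two successors and both x and `y` can be inserted into the
  -- cycle.
  obtain ⟨s, hs, t, ht, hst⟩ := Finset.one_lt_card.1 (show 1 < (G.sideNbrs N f x 1 y).card by omega)
  rw [mem_sideNbrs, mem_contacts] at hs ht
  rcases lt_or_gt_of_ne hst with hlt | hlt
  · exact h.longest.not_adj_two_succ h.off hy hyx hlt (by omega) hs.1.2 ht.1.2 hs.2 ht.2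
  · exact h.longest.not_adj_two_succ h.off hy hyx hlt (by omega) ht.1.2 hs.1.2 ht.2 hs.2

end Bypassed

end SimpleGraph

/-! ### Edges of the cycle with non-free ends. -/

namespace SimpleGraph

variable {V : Type*} {G : SimpleGraph V}

variable {m N : ℕ} {f : ℤ → V} {x v w : V} {e t : ℤ}

namespace Bypassed

/-- A contact at `N - 1` would have `f 0` as its successor, and successors of contacts are free. -/
lemma contact_lt (h : G.Bypassed m N f x) (hs : ¬ G.FreeAt f x 1 (f 0))
    (ht : t ∈ G.contacts N f x) : t < N - 1 := by
  have h1 := mem_contacts.1 ht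
  rcases (show t ≤ N - 1 by omega).lt_or_eq with hlt | rfl
  · exact hlt
  · refine absurd (h.freeAt_side (Or.inl rfl) h1.2) ?_
    rwa [h.longest.toIsCyc.eq_of (i := (N : ℤ) - 1 + 1) (j := 0) (by omega)]

lemma not_adj_last (h : G.Bypassed m N f x) (hs : ¬ G.FreeAt f x 1 (f 0)) :
    ¬ G.Adj (f (N - 1)) x := by
  intro hp
  have h3 := h.longest.three_le
  have := h.contact_lt hs (mem_contacts.2 ⟨⟨by omega, by omega⟩, hp.symm⟩)
  omega

/-- If neither end of the edge joining `f (N - 1)` to `f 0` is free, then the neighbours of `f 0`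
among the successors of contacts come strictly before those of `f (N - 1)`. -/
lemma lt_of_mem_sideNbrs (h : G.Bypassed m N f x) (hs : ¬ G.FreeAt f x 1 (f 0)) {t' : ℤ}
    (ht : t ∈ G.sideNbrs N f x 1 (f (N - 1))) (ht' : t' ∈ G.sideNbrs N f x 1 (f 0)) : t' < t := by
  have h3 := h.longest.three_le
  rw [mem_sideNbrs] at ht ht'
  obtain ⟨htc, htp⟩ := ht
  obtain ⟨htc', hts⟩ := ht'
  have hlt := h.contact_lt hs htc
  have hlt' := h.contact_lt hs htc'
  have hm := mem_contacts.1 htc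
  have hm' := mem_contacts.1 htc'
  by_contra hcon
  rcases (not_lt.1 hcon).lt_or_eq with hl | rfl
  · exact h.longest.not_crossing h.off hm.1.1 hl hlt' hm.2 hm'.2 htp hts
  have hne : t + 1 ≠ N - 1 := by
    intro heq; rw [heq] at htp; exact htp.ne rfl
  have hadj : G.Adj (f (t + 2)) (f (t + 1)) := by
    have := h.longest.adj (t + 1)
    rw [show t + 1 + 1 = t + 2 by ring] at this
    exact this.symm
  -- In the case t = t', `f (t + 1)` sees both `f 0` and `f (N - 1)`. It suffices to reroute the
  -- rest of the cycle through x without it. Its neighbour `f (t + 2)` either sees x or is non-free,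
  -- hence sees a second successor `f (r + 1)`.
  obtain ⟨L, hL, hLp⟩ : ∃ L, G.IsSeg L (f 0) (f (N - 1)) ∧
      (f (t + 1) :: L).Perm (x :: seg f 0 (N - 1)) := by
    by_cases hw : G.Adj x (f (t + 2))
    · exact h.longest.exists_reroute_of_adj hm.1.1 (by omega) hm.2 hw
    · have hc := h.card_sideNbrs (v := f (t + 2)) (Or.inl rfl) (fun hf => hf.2 t hm.2 hadj)
        (fun h' => hw h'.symm)
      have hd := h.deg
      have h1 := h.one_le
      obtain ⟨r, hr, hrt⟩ := Finset.exists_mem_ne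
        (show 1 < (G.sideNbrs N f x 1 (f (t + 2))).card by omega) t
      rw [mem_sideNbrs] at hr
      have hrm := mem_contacts.1 hr.1
      have hrlt := h.contact_lt hs hr.1
      refine h.longest.exists_reroute hm.1.1 (by omega) hrm.1.1 (by omega) hrt.symm ?_ hm.2 hrm.2
        hr.2
      rintro rfl
      exact h.longest.not_adj_succ h.off hm.2 hrm.2
  exact h.longest.not_reroute h.off hL hLp hts.symm htp.symm

lemma le_of_mem_sideNbrs (h : G.Bypassed m N f x) {t' : ℤ}
    (ht : t ∈ G.sideNbrs N f x (-1) (f (N - 1))) (ht' : t' ∈ G.sideNbrs N f x 1 (f 0)) :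
    t ≤ t' := by
  rw [mem_sideNbrs, mem_contacts] at ht ht'
  by_contra hlt
  exact h.longest.not_mixed_crossing h.off ht'.1.1.1 (not_le.1 hlt) (by omega) ht'.1.2 ht.1.2
    ht'.2 ht.2

/-- Each of `A`, `B`, `C` has at least d + 1 - m contacts. All of `A` lies weakly before `B`, and
`B` strictly before `C`, so `B` and `C` are disjoint and `A` meets their union at most once. Thus
3(d + 1 - m) - 1 ≤ d, against 2d ≥ 3m. -/
lemma false_of_not_freeAt (h : G.Bypassed m N f x) (hs : ¬ G.FreeAt f x 1 (f 0))
    (hsx : ¬ G.Adj (f 0) x) (hp : ¬ G.FreeAt f x 1 (f (N - 1)))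
    (hp' : ¬ G.FreeAt f x (-1) (f (N - 1))) : False := by
  classical
  have hpx := h.not_adj_last hs
  have h1 := h.card_sideNbrs (Or.inr rfl) hp' hpx
  have h2 := h.card_sideNbrs (Or.inl rfl) hs hsx
  have h3 := h.card_sideNbrs (Or.inl rfl) hp hpx
  set A := G.sideNbrs N f x (-1) (f (N - 1))
  set B := G.sideNbrs N f x 1 (f 0)
  set C := G.sideNbrs N f x 1 (f (N - 1))
  have hBC : Disjoint B C := Finset.disjoint_left.2 fun t hB hC =>
    (h.lt_of_mem_sideNbrs hs hC hB).false
  have hd := h.deg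
  have hm := h.one_le
  have hBne : B.Nonempty := Finset.card_pos.1 (by omega)
  obtain ⟨b, hb⟩ := hBne
  have hint : (A ∩ (B ∪ C)).card ≤ 1 := by
    refine Finset.card_le_one.2 fun s hs' t ht => ?_
    simp only [Finset.mem_inter, Finset.mem_union] at hs' ht
    have key : ∀ {s t}, s ∈ A → (t ∈ B ∨ t ∈ C) → s ≤ t := by
      rintro s t hs' (ht | ht)
      · exact h.le_of_mem_sideNbrs hs' ht
      · exact (h.le_of_mem_sideNbrs hs' hb).trans (h.lt_of_mem_sideNbrs hs ht hb).le
    exact le_antisymm (key hs'.1 ht.2) (key ht.1 hs'.2)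
  have hunion : (A ∪ (B ∪ C)).card ≤ (G.neighborSet x).ncard := by
    rw [← h.card_contacts]
    exact Finset.card_le_card (Finset.union_subset sideNbrs_subset
      (Finset.union_subset sideNbrs_subset sideNbrs_subset))
  have h4 := Finset.card_union_add_card_inter A (B ∪ C)
  rw [Finset.card_union_of_disjoint hBC] at h4
  omega

/-- The contacts seen from the two ends are disjoint sets of sizes at least d - m and d + 1 - m
among d contacts. -/
lemma degree_lt (h : G.Bypassed m N f x) (h0 : G.Adj x (f 0))
    (hz : ¬ G.FreeAt f x 1 (f (N - 1))) : (G.neighborSet x).ncard + 1 ≤ 2 * m := by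
  classical
  have hs : ¬ G.FreeAt f x 1 (f 0) := fun hf => hf.1 h0.symm
  have h2 := h.card_sideNbrs_of_adj (Or.inl rfl) h0.symm
  have h3 := h.card_sideNbrs (Or.inl rfl) hz (h.not_adj_last hs)
  have hd : Disjoint (G.sideNbrs N f x 1 (f 0)) (G.sideNbrs N f x 1 (f (N - 1))) :=
    Finset.disjoint_left.2 fun t hB hC => (h.lt_of_mem_sideNbrs hs hC hB).false
  have := Finset.card_le_card (Finset.union_subset (sideNbrs_subset (v := f 0) (e := 1))
    (sideNbrs_subset (v := f (N - 1)) (G := G) (N := N) (f := f) (x := x) (e := 1)))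
  rw [Finset.card_union_of_disjoint hd, h.card_contacts] at this
  omega

/-- Otherwise `f 1` sees many predecessors, giving a third set `U` of contacts. Apart from its
maximum `T`, it lies strictly between 0 and the rest of `A`, hence before `Z`. The three sets are
then too large for the d contacts. -/
lemma freeAt_succ_zero (h : G.Bypassed m N f x) (hm : 3 ≤ m) (h0 : G.Adj x (f 0))
    (hz : ¬ G.FreeAt f x 1 (f (N - 1))) : G.FreeAt f x (-1) (f 1) := by
  classical
  by_contra hu
  have h3 := h.longest.three_le
  have hs : ¬ G.FreeAt f x 1 (f 0) := fun hf => hf.1 h0.symm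
  have hd := h.deg
  have hux : ¬ G.Adj (f 1) x := fun h' => h.longest.not_adj_succ h.off h0 (by simpa using h'.symm)
  have c1 := h.card_sideNbrs_of_adj (Or.inl rfl) h0.symm
  have c2 := h.card_sideNbrs (Or.inl rfl) hz (h.not_adj_last hs)
  have c3 := h.card_sideNbrs (Or.inr rfl) hu hux
  set A := G.sideNbrs N f x 1 (f 0) with hA
  set Z := G.sideNbrs N f x 1 (f (N - 1)) with hZ
  set U := G.sideNbrs N f x (-1) (f 1) with hU
  have hlt : ∀ {s t}, s ∈ A → t ∈ Z → s < t := fun hs' ht => h.lt_of_mem_sideNbrs hs ht hs'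
  have h0A : (0 : ℤ) ∈ A := by
    rw [hA, mem_sideNbrs, mem_contacts]
    exact ⟨⟨⟨le_rfl, by omega⟩, h0⟩, h.longest.adj 0⟩
  have hUpos : ∀ t ∈ U, 0 < t := by
    intro t ht
    rw [hU, mem_sideNbrs, mem_contacts] at ht
    rcases ht.1.1.1.lt_or_eq with hlt' | rfl
    · exact hlt'
    -- A zero in `U` means that `f 1` sees `f (-1) = f (N - 1)`, which puts 0 into both `A` and `Z`.
    · refine absurd (hlt h0A (t := 0) ?_) (lt_irrefl _)
      rw [hZ, mem_sideNbrs, mem_contacts]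
      refine ⟨ht.1, ?_⟩
      rw [h.longest.toIsCyc.eq_of (i := (N : ℤ) - 1) (j := 0 + -1) (by omega)]
      exact ht.2.symm
  have hUne : U.Nonempty := Finset.card_pos.1 (by omega)
  obtain ⟨T, hT, hTmax⟩ : ∃ T ∈ U, ∀ t ∈ U, t ≤ T := ⟨U.max' hUne, U.max'_mem _, U.le_max'⟩
  have hAT : ∀ q ∈ A, q ≠ 0 → T ≤ q := by
    intro q hq hq0
    rw [hA, mem_sideNbrs, mem_contacts] at hq
    have hT' := hT
    rw [hU, mem_sideNbrs, mem_contacts] at hT'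
    by_contra hcon
    refine h.longest.not_adj_succ_of_lt h.off (q := q) (t := T) (by omega) (by omega) (by omega)
      hq.1.2 hT'.1.2 hT'.2.symm hq.2
  -- This needs d - m ≥ 2, which is where m ≥ 3 is used.
  have hAne : (A.erase 0).Nonempty := by
    rw [← Finset.card_pos, Finset.card_erase_of_mem h0A]; omega
  obtain ⟨q, hq⟩ := hAne
  rw [Finset.mem_erase] at hq
  have d1 : Disjoint A Z := Finset.disjoint_left.2 fun t hB hC => (hlt hB hC).false
  have d2 : Disjoint (U.erase T) (A ∪ Z) := by
    refine Finset.disjoint_left.2 fun t ht ht' => ?_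
    rw [Finset.mem_erase] at ht
    have h1 := hTmax t ht.2
    have h2 := hUpos t ht.2
    have h4 : t < T := lt_of_le_of_ne h1 ht.1
    rw [Finset.mem_union] at ht'
    rcases ht' with ht' | ht'
    · have := hAT t ht' h2.ne'; omega
    · have := hlt hq.2 ht'
      have := hAT q hq.2 hq.1
      omega
  have hsub : U.erase T ∪ (A ∪ Z) ⊆ G.contacts N f x :=
    Finset.union_subset ((Finset.erase_subset _ _).trans sideNbrs_subset)
      (Finset.union_subset sideNbrs_subset sideNbrs_subset)
  have hc := Finset.card_le_card hsub
  rw [Finset.card_union_of_disjoint d2, Finset.card_union_of_disjoint d1, h.card_contacts,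
    Finset.card_erase_of_mem hT] at hc
  omega

lemma freeAt_succ_of_not_freeAt_pred (h : G.Bypassed m N f x) (hm : 3 ≤ m) (h0 : G.Adj x (f t))
    (hz : ¬ G.FreeAt f x 1 (f (t - 1))) : G.FreeAt f x (-1) (f (t + 1)) := by
  have := (h.shift t).freeAt_succ_zero hm (by simpa using h0) (by
    rw [freeAt_shift]
    rwa [h.longest.toIsCyc.eq_of (i := (N : ℤ) - 1 + t) (j := t - 1) (by omega)])
  rw [freeAt_shift] at this
  rwa [add_comm t 1]

/-- If `f (N - 1)` is not free, then for each `l` in `Z` both `f (l + 1)` and `f (l - 1)` are free.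
Omitting only the predecessor of the least `l`, they all avoid the edge from `f 0` to x, which gives
2(d + 1 - m) - 1 ≤ m, against 2d ≥ 3m. -/
lemma freeAt_pred_zero (h : G.Bypassed m N f x) (hm : 3 ≤ m) (h0 : G.Adj x (f 0)) :
    G.FreeAt f x 1 (f (N - 1)) := by
  classical
  by_contra hz
  have h3 := h.longest.three_le
  have hs : ¬ G.FreeAt f x 1 (f 0) := fun hf => hf.1 h0.symm
  have hd := h.deg
  have c2 := h.card_sideNbrs (Or.inl rfl) hz (h.not_adj_last hs)
  set Z := G.sideNbrs N f x 1 (f (N - 1)) with hZ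
  have hlast : f (N - 1) = f (0 + -1) := h.longest.toIsCyc.eq_of (by omega)
  have hmem : ∀ l ∈ Z, (0 ≤ l ∧ l < N) ∧ G.Adj x (f l) ∧ G.Adj (f (N - 1)) (f (l + 1)) := by
    intro l hl
    rw [hZ, mem_sideNbrs, mem_contacts] at hl
    exact ⟨hl.1.1, hl.1.2, hl.2⟩
  have hfree : ∀ l ∈ Z, G.FreeAt f x 1 (f (l + -1)) := by
    intro l hl
    -- If `f (l - 1)` were not free, `f (l + 1)` would see no predecessor of a contact; but it sees
    -- `f (N - 1)`, the predecessor of the contact `f 0`.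
    by_contra hcon
    refine (h.freeAt_succ_of_not_freeAt_pred hm (hmem l hl).2.1 hcon).2 0 h0 ?_
    rw [← hlast]
    exact (hmem l hl).2.2.symm
  have hZne : Z.Nonempty := Finset.card_pos.1 (by omega)
  obtain ⟨T, hT, hTmin⟩ : ∃ T ∈ Z, ∀ t ∈ Z, T ≤ t := ⟨Z.min' hZne, Z.min'_mem _, Z.min'_le⟩
  have hdisj : Disjoint (Z.image fun l => f (l + 1)) ((Z.erase T).image fun l => f (l + -1)) := by
    refine Finset.disjoint_left.2 fun u hu hu' => ?_
    rw [Finset.mem_image] at hu hu'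
    obtain ⟨l, hl, rfl⟩ := hu
    obtain ⟨r, hr, hrl⟩ := hu'
    have h1 := (hmem l hl).2.2
    rw [← hrl, hlast] at h1
    exact h.not_adj_side_side (Or.inr rfl) h0 (hmem r (Finset.mem_of_mem_erase hr)).2.1 h1
  have hall : ∀ u ∈ (Z.image fun l => f (l + 1)) ∪ ((Z.erase T).image fun l => f (l + -1)),
      G.FreeAt f x 1 u ∧ ¬ G.Adj (f 0) u := by
    intro u hu
    rw [Finset.mem_union, Finset.mem_image, Finset.mem_image] at hu
    rcases hu with ⟨l, hl, rfl⟩ | ⟨l, hl, rfl⟩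
    · refine ⟨h.freeAt_side (Or.inl rfl) (hmem l hl).2.1, fun hadj => ?_⟩
      refine (h.lt_of_mem_sideNbrs hs hl (t' := l) ?_).false
      rw [mem_sideNbrs]
      exact ⟨sideNbrs_subset hl, hadj⟩
    · rw [Finset.mem_erase] at hl
      refine ⟨hfree l hl.2, fun hadj => ?_⟩
      have hTm := hmem T hT
      have hlm := hmem l hl.2
      exact h.longest.not_adj_pred_of_lt h.off hTm.1.1 (lt_of_le_of_ne (hTmin l hl.2) hl.1.symm)
        (by omega) hTm.2.1 hlm.2.1 hTm.2.2 hadj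
  have hbound := h.edge (f 0) x h0.symm _
    (fun a ha b hb => h.freeAt_indep (Or.inl rfl) (hall a ha).1 (hall b hb).1)
    (fun a ha => ⟨(hall a ha).2, fun h' => (hall a ha).1.1 h'.symm⟩)
  rw [Finset.card_union_of_disjoint hdisj, Finset.card_image_of_injOn,
    Finset.card_image_of_injOn, Finset.card_erase_of_mem hT] at hbound
  · omega
  · exact (h.side_injOn (-1)).mono (Finset.coe_subset.2
      ((Finset.erase_subset _ _).trans sideNbrs_subset))
  · exact (h.side_injOn 1).mono (Finset.coe_subset.2 sideNbrs_subset)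

lemma freeAt_pred (h : G.Bypassed m N f x) (hm : 3 ≤ m) (h0 : G.Adj x (f t)) :
    G.FreeAt f x 1 (f (t - 1)) := by
  have := (h.shift t).freeAt_pred_zero hm (by simpa using h0)
  rw [freeAt_shift] at this
  rwa [h.longest.toIsCyc.eq_of (i := (N : ℤ) - 1 + t) (j := t - 1) (by omega)] at this

/-- If the independence number is at most half of the order, then some edge of the cycle has no
free end. -/
lemma exists_not_freeAt_edge [Fintype V] (h : G.Bypassed m N f x)
    (hα : ∀ S : Finset V, (∀ a ∈ S, ∀ b ∈ S, ¬ G.Adj a b) → 2 * S.card ≤ Fintype.card V) :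
    ∃ t, ¬ G.FreeAt f x 1 (f (t - 1)) ∧ ¬ G.FreeAt f x 1 (f t) := by
  classical
  by_contra! hcon
  have hcyc := h.longest.toIsCyc
  set C := (Finset.Ico (0 : ℤ) N).image f with hC
  have hinj : ∀ c, Set.InjOn (fun t => f (t + c)) (Finset.Ico (0 : ℤ) N) := by
    intro c s hs t ht hst
    rw [Finset.mem_coe, Finset.mem_Ico] at hs ht
    rcases lt_trichotomy s t with hlt | rfl | hlt
    · exact absurd hst (hcyc.ne_of (by omega) (by omega))
    · rfl
    · exact absurd hst.symm (hcyc.ne_of (by omega) (by omega))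
  have hmemC : ∀ i, f i ∈ C := by
    intro i
    obtain ⟨t, h0, h1, ht⟩ := hcyc.exists_mem_Ico 0 i
    have := ht 0
    rw [add_zero, add_zero] at this
    exact Finset.mem_image.2 ⟨t, Finset.mem_Ico.2 ⟨h0, by omega⟩, this⟩
  have hCcard : C.card = N := by
    rw [hC, Finset.card_image_of_injOn (by simpa using hinj 0)]; simp
  set I := C.filter (G.FreeAt f x 1) with hI
  have hcount : ∀ c, ((Finset.Ico (0 : ℤ) N).filter fun t => G.FreeAt f x 1 (f (t + c))).card
      ≤ I.card := by
    intro c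
    rw [← Finset.card_image_of_injOn
      ((hinj c).mono (Finset.coe_subset.2 (Finset.filter_subset _ _)))]
    refine Finset.card_le_card fun u hu => ?_
    rw [Finset.mem_image] at hu
    obtain ⟨t, ht, rfl⟩ := hu
    exact Finset.mem_filter.2 ⟨hmemC _, (Finset.mem_filter.1 ht).2⟩
  -- Every position or its predecessor is free, so two translates of the free positions cover a full
  -- period. With the vertices off the cycle, of which x is one, this exceeds half of the order.
  have hN : N ≤ 2 * I.card := by
    have hcov : Finset.Ico (0 : ℤ) N ⊆
        ((Finset.Ico (0 : ℤ) N).filter fun t => G.FreeAt f x 1 (f (t + -1))) ∪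
          ((Finset.Ico (0 : ℤ) N).filter fun t => G.FreeAt f x 1 (f (t + 0))) := by
      intro t ht
      rw [Finset.mem_union, Finset.mem_filter, Finset.mem_filter, add_zero]
      by_cases hf : G.FreeAt f x 1 (f (t + -1))
      · exact Or.inl ⟨ht, hf⟩
      · exact Or.inr ⟨ht, hcon t hf⟩
    have h1 := (Finset.card_le_card hcov).trans (Finset.card_union_le _ _)
    have h2 := hcount (-1)
    have h4 := hcount 0
    rw [Int.card_Ico] at h1
    omega
  have hoff : ∀ y ∈ Cᶜ, G.FreeAt f x 1 y := by
    intro y hy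
    rw [Finset.mem_compl] at hy
    exact h.freeAt_of_off fun i hi => hy (hi ▸ hmemC i)
  have hall : ∀ a ∈ I ∪ Cᶜ, G.FreeAt f x 1 a := by
    intro a ha
    rcases Finset.mem_union.1 ha with ha | ha
    · exact (Finset.mem_filter.1 ha).2
    · exact hoff a ha
  have hb := hα (I ∪ Cᶜ) fun a ha b hb => h.freeAt_indep (Or.inl rfl) (hall a ha) (hall b hb)
  rw [Finset.card_union_of_disjoint] at hb
  · have hx : x ∈ Cᶜ := by
      rw [Finset.mem_compl, hC, Finset.mem_image]
      rintro ⟨i, -, hi⟩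
      exact h.off i hi
    have h1 := Finset.card_pos.2 ⟨x, hx⟩
    have h2 := Finset.card_add_card_compl C
    omega
  · exact Finset.disjoint_left.2 fun a ha ha' =>
      (Finset.mem_compl.1 ha') (Finset.mem_filter.1 ha).1

/-- If the independence number is at most half of the order, then some neighbour of `x` on the cycle
is preceded by a vertex that is not free. -/
lemma exists_not_freeAt_pred [Fintype V] (h : G.Bypassed m N f x)
    (hα : ∀ S : Finset V, (∀ a ∈ S, ∀ b ∈ S, ¬ G.Adj a b) → 2 * S.card ≤ Fintype.card V) :
    ∃ t, G.Adj x (f t) ∧ ¬ G.FreeAt f x 1 (f (t - 1)) := by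
  by_contra! hcon
  obtain ⟨t, hp, hs⟩ := h.exists_not_freeAt_edge hα
  have hsx : ¬ G.Adj x (f t) := fun h' => hp (hcon t h')
  have hlast : f ((N : ℤ) - 1 + t) = f (t - 1) := h.longest.toIsCyc.eq_of (by omega)
  refine (h.shift t).false_of_not_freeAt ?_ ?_ ?_ ?_
  · rw [freeAt_shift]; simpa using hs
  · simpa using fun h' : G.Adj (f t) x => hsx h'.symm
  · rw [freeAt_shift, hlast]; exact hp
  · rw [freeAt_shift, hlast]
    intro hf
    -- Since predecessors of contacts are assumed free, they see no successor, so successors are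
    -- also free in the mirrored sense. Hence freeness of `f (t - 1)` for `e = -1` would give it for
    -- `e = 1`.
    have key : ∀ s, G.Adj x (f s) → G.FreeAt f x (-1) (f (s + 1)) := by
      intro s hs'
      refine ⟨fun h' => h.not_adj_side (Or.inl rfl) hs' h'.symm, fun r hr hadj => ?_⟩
      exact h.freeAt_indep (Or.inl rfl) (h.freeAt_side (Or.inl rfl) hs') (hcon r hr) hadj
    exact hp ⟨hf.1, fun s hs' hadj => h.freeAt_indep (Or.inr rfl) hf (key s hs') hadj⟩

/-- The exceptional situation is confined to `m = 2` and vertices of degree three. -/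
lemma eq_two [Fintype V] (h : G.Bypassed m N f x)
    (hα : ∀ S : Finset V, (∀ a ∈ S, ∀ b ∈ S, ¬ G.Adj a b) → 2 * S.card ≤ Fintype.card V) :
    m = 2 ∧ (G.neighborSet x).ncard = 3 := by
  obtain ⟨t, ht, hz⟩ := h.exists_not_freeAt_pred hα
  have hm : ¬ 3 ≤ m := fun hm => hz (h.freeAt_pred hm ht)
  have hlast : f ((N : ℤ) - 1 + t) = f (t - 1) := h.longest.toIsCyc.eq_of (by omega)
  have := (h.shift t).degree_lt (by simpa using ht) (by rw [freeAt_shift, hlast]; exact hz)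
  -- With m ≤ 2, the inequalities d + 1 ≤ 2m and 2d ≥ 3m leave only m = 2, d = 3.
  have := h.deg
  omega

end Bypassed

end SimpleGraph

/-! ### Existence of longest cycles and independence of their complements. -/

namespace SimpleGraph

variable {V : Type*} {G : SimpleGraph V}

variable {m N : ℕ} {f : ℤ → V} {x v w : V} {e t : ℤ}

lemma IsCyc.le_card [Fintype V] (h : G.IsCyc N f) : N ≤ Fintype.card V := by
  have := (h.nodup_seg (a := 0) (b := N - 1) (by omega)).length_le_card
  rw [length_seg] at this
  omega

lemma Walk.IsCycle.exists_isCyc {p : G.Walk v v} (hp : p.IsCycle) : ∃ N f, G.IsCyc N f := by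
  cases p with
  | nil => simp at hp
  | cons hadj q =>
    have h3 := hp.three_le_length
    rw [Walk.length_cons] at h3
    have hnd : q.support.Nodup := by simpa using hp.support_nodup
    have hseg : G.IsSeg q.support _ v := ⟨q.isChain_adj_support, by
      rw [List.head?_eq_some_head q.support_ne_nil, Walk.head_support], by
      rw [List.getLast?_eq_some_getLast q.support_ne_nil, Walk.getLast_support]⟩
    obtain ⟨f, hf, -⟩ := hseg.exists_isCyc hadj hnd (by rw [Walk.length_support]; omega)
    exact ⟨_, f, hf⟩

lemma IsKConnected.connected [Fintype V] {k : ℕ} (h : G.IsKConnected k) (hk : 1 ≤ k) :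
    G.Connected := by
  have hc := h.2 ∅ (by rw [Finset.card_empty]; omega)
  have : Nonempty V := Fintype.card_pos_iff.1 (by have := h.1; omega)
  refine ⟨fun a b => ?_⟩
  exact (hc.preconnected ⟨a, by simp⟩ ⟨b, by simp⟩).map (Embedding.induce _).toHom

/-- A connected graph of minimum degree at least two has a longest cycle. -/
lemma Connected.exists_isLongest [Fintype V] [DecidableRel G.Adj] (hG : G.Connected)
    (hd : ∀ v, 2 ≤ G.degree v) : ∃ N f, G.IsLongest N f := by
  classical
  have hcyc : ∃ N f, G.IsCyc N f := by
    by_contra hcon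
    have hac : G.IsAcyclic := fun v p hp => hcon hp.exists_isCyc
    -- A tree has fewer edges than vertices, whereas the degree sum here is at least twice the
    -- order.
    have htree : G.IsTree := ⟨hG, hac⟩
    have h1 := htree.card_edgeFinset
    have h2 := G.sum_degrees_eq_twice_card_edges
    have h3 := Finset.sum_le_sum fun v (_ : v ∈ Finset.univ) => hd v
    simp only [Finset.sum_const, Finset.card_univ, smul_eq_mul] at h3
    omega
  obtain ⟨N, f, hf⟩ := hcyc
  have hmax := Nat.findGreatest_spec (P := fun N => ∃ f, G.IsCyc N f) hf.le_card ⟨f, hf⟩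
  obtain ⟨g, hg⟩ := hmax
  exact ⟨_, g, hg, fun M g' hg' => Nat.le_findGreatest hg'.le_card ⟨g', hg'⟩⟩

/-- `v` can be reached from `y` without meeting the cycle `f`. -/
def OffReach (G : SimpleGraph V) (f : ℤ → V) (y v : V) : Prop :=
  ∃ (hy : ∀ i, f i ≠ y) (hv : ∀ i, f i ≠ v),
    (G.induce {v | ∀ i, f i ≠ v}).Reachable ⟨y, hy⟩ ⟨v, hv⟩

lemma OffReach.step {y : V} (h : G.OffReach f y v) (hvw : G.Adj v w) (hw : ∀ i, f i ≠ w) :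
    G.OffReach f y w := by
  obtain ⟨hy, hv, hr⟩ := h
  refine ⟨hy, hw, hr.trans (Adj.reachable ?_)⟩
  simpa using hvw

lemma OffReach.exists_isSeg {y : V} (hv : G.OffReach f y v) (hw : G.OffReach f y w) :
    ∃ L, G.IsSeg L v w ∧ L.Nodup ∧ ∀ e ∈ L, ∀ i, f i ≠ e := by
  classical
  obtain ⟨hy, hv, hr⟩ := hv
  obtain ⟨_, hw, hr'⟩ := hw
  obtain ⟨p, hp⟩ := (hr.symm.trans hr').exists_isPath
  refine ⟨p.support.map Subtype.val, ⟨?_, ?_, ?_⟩, ?_, ?_⟩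
  · rw [List.isChain_map]
    exact p.isChain_adj_support.imp fun a b hab => by simpa using hab
  · rw [List.head?_map, List.head?_eq_some_head p.support_ne_nil, Walk.head_support]; rfl
  · rw [List.getLast?_map, List.getLast?_eq_some_getLast p.support_ne_nil, Walk.getLast_support]
    rfl
  · exact hp.support_nodup.map Subtype.val_injective
  · intro e he
    obtain ⟨a, -, rfl⟩ := List.mem_map.1 he
    exact a.2

namespace IsLongest

lemma offReach_not_adj_succ (h : G.IsLongest N f) {y : V} (hv : G.OffReach f y v)
    (hw : G.OffReach f y w) (h0 : G.Adj v (f t)) (h1 : G.Adj w (f (t + 1))) : False := by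
  have h3 := h.three_le
  obtain ⟨L, hL, hnd, hoff⟩ := hv.exists_isSeg hw
  refine h.not_perm (a := t + 1) (b := t + N)
    (hL.append (isSeg_seg h.adj (by omega)) h1) ?_ (by ring) (List.Perm.refl _) hnd hoff hL.ne_nil
  rw [h.toIsCyc.eq_of (i := t + N) (j := t) (by omega)]
  exact h0.symm

lemma offReach_not_adj_succ_succ (h : G.IsLongest N f) {y : V} (hv : G.OffReach f y v)
    (hw : G.OffReach f y w) {t' : ℤ} (h0 : G.Adj v (f t)) (h1 : G.Adj w (f t')) (htt : t < t')
    (ht' : t' < t + N) (hadj : G.Adj (f (t + 1)) (f (t' + 1))) : False := by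
  classical
  have h3 := h.three_le
  obtain ⟨L, hL, hnd, hoff⟩ := hv.exists_isSeg hw
  refine h.not_perm (a := t + 1) (b := t + N)
    (hL.append ((isSeg_seg h.adj (a := t + 1) (b := t') (by omega)).reverse.append
      (isSeg_seg h.adj (a := t' + 1) (b := t + N) (by omega)) hadj) h1) ?_ (by ring) ?_ hnd hoff
      hL.ne_nil
  · rw [h.toIsCyc.eq_of (i := t + N) (j := t) (by omega)]
    exact h0.symm
  · rw [← seg_append f (a := t + 1) (b := t') (c := t + N) (by omega) (by omega)]
    simp only [List.perm_iff_count, List.count_append, List.count_reverse]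
    intro; trivial

/-- In an `(m + 1)`-connected graph satisfying `EdgeBound`, the complement of a longest cycle is
independent. -/
lemma off_indep [Fintype V] (h : G.IsLongest N f) (hE : G.EdgeBound m)
    (hk : G.IsKConnected (m + 1)) {y z : V} (hy : ∀ i, f i ≠ y) (hz : ∀ i, f i ≠ z) :
    ¬ G.Adj y z := by
  classical
  intro hyz
  have h3 := h.three_le
  have hyy : G.OffReach f y y := ⟨hy, hy, Reachable.refl _⟩
  have hyz' : G.OffReach f y z := hyy.step hyz hz
  let P : ℤ → Prop := fun t => ∃ v, G.OffReach f y v ∧ G.Adj v (f t)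
  have hP1 : ∀ t, P t → ¬ P (t + 1) := by
    rintro t ⟨v, hv, hvt⟩ ⟨w, hw, hwt⟩
    exact h.offReach_not_adj_succ hv hw hvt hwt
  have hP2 : ∀ t t', P t → P t' → t < t' → t' < t + N → ¬ G.Adj (f (t + 1)) (f (t' + 1)) := by
    rintro t t' ⟨v, hv, hvt⟩ ⟨w, hw, hwt⟩ h1 h2 hadj
    exact h.offReach_not_adj_succ_succ hv hw hvt hwt h1 h2 hadj
  set A := (Finset.Ico (0 : ℤ) N).filter P with hA
  have hAm : ∀ t ∈ A, (0 ≤ t ∧ t < N) ∧ P t := by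
    intro t ht
    rw [hA, Finset.mem_filter, Finset.mem_Ico] at ht
    exact ht
  have hinj : ∀ c, Set.InjOn (fun t => f (t + c)) A := by
    intro c s hs t ht hst
    have hs := (hAm s hs).1
    have ht := (hAm t ht).1
    rcases lt_trichotomy s t with hlt | rfl | hlt
    · exact absurd hst (h.toIsCyc.ne_of (by omega) (by omega))
    · rfl
    · exact absurd hst.symm (h.toIsCyc.ne_of (by omega) (by omega))
  -- The successors of the attachment vertices are independent and miss the edge `y z`.
  have hcard : A.card ≤ m := by
    rw [← Finset.card_image_of_injOn (hinj 1)]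
    refine hE y z hyz _ (fun a ha b hb => ?_) (fun a ha => ?_)
    · rw [Finset.mem_image] at ha hb
      obtain ⟨s, hs, rfl⟩ := ha
      obtain ⟨t, ht, rfl⟩ := hb
      have hs := hAm s hs
      have ht := hAm t ht
      rcases lt_trichotomy s t with hlt | rfl | hlt
      · exact hP2 s t hs.2 ht.2 hlt (by omega)
      · exact G.loopless.irrefl _
      · exact fun hadj => hP2 t s ht.2 hs.2 hlt (by omega) hadj.symm
    · rw [Finset.mem_image] at ha
      obtain ⟨s, hs, rfl⟩ := ha
      have hs := hAm s hs
      exact ⟨fun hadj => hP1 s hs.2 ⟨y, hyy, hadj⟩, fun hadj => hP1 s hs.2 ⟨z, hyz', hadj⟩⟩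
  set X := A.image f with hX
  have hXm : ∀ i, f i ∈ X ↔ P i := by
    intro i
    constructor
    · intro hi
      obtain ⟨s, hs, hsi⟩ := Finset.mem_image.1 hi
      obtain ⟨v, hv, hvs⟩ := (hAm s hs).2
      exact ⟨v, hv, hsi ▸ hvs⟩
    · rintro ⟨v, hv, hvi⟩
      obtain ⟨s, h0, h1, hs⟩ := h.toIsCyc.exists_mem_Ico 0 i
      have hs := hs 0
      rw [add_zero, add_zero] at hs
      refine Finset.mem_image.2 ⟨s, ?_, hs⟩
      rw [hA, Finset.mem_filter, Finset.mem_Ico]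
      exact ⟨⟨h0, by omega⟩, v, hv, by rw [hs]; exact hvi⟩
  have hconn := hk.2 X (by
    have : X.card ≤ A.card := Finset.card_image_le
    omega)
  obtain ⟨i, hi⟩ : ∃ i, ¬ P i := by
    by_cases h0 : P 0
    · exact ⟨0 + 1, hP1 0 h0⟩
    · exact ⟨0, h0⟩
  have hyX : y ∉ X := by
    intro hyX
    obtain ⟨s, -, hs⟩ := Finset.mem_image.1 hyX
    exact hy s hs
  obtain ⟨p⟩ := hconn.preconnected ⟨y, hyX⟩ ⟨f i, fun hf => hi ((hXm i).1 hf)⟩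
  -- A walk avoiding the attachment set `X` cannot leave the component of `y` off the cycle, yet `X`
  -- is too small to separate.
  have key : ∀ (a b : {v | v ∉ X}), (G.induce {v | v ∉ X}).Walk a b → G.OffReach f y a →
      G.OffReach f y b := by
    intro a b q
    induction q with
    | nil => exact id
    | @cons a b c hab q ih =>
      intro ha
      refine ih (ha.step (by simpa using hab) fun i hi => b.2 ?_)
      rw [← hi, hXm]
      exact ⟨a, ha, by rw [hi]; simpa using hab⟩
  obtain ⟨-, hoff, -⟩ := key _ _ p hyy
  exact hoff i rfl

end IsLongest

/-- In a highly connected graph, a non-hamiltonian situation yields a vertex bypassed by a longest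
cycle. -/
lemma exists_bypassed [Fintype V] [DecidableEq V] [DecidableRel G.Adj] (hm : 1 ≤ m)
    (hE : G.EdgeBound m) (hk : G.IsKConnected (m + 1)) (hd : ∀ v, 3 * m ≤ 2 * G.degree v)
    (hham : ¬ G.IsHamiltonian) :
    ∃ N f, G.IsLongest N f ∧ (∃ x, ∀ i, f i ≠ x) ∧
      ∀ g, G.IsLongest N g → ∀ x, (∀ i, g i ≠ x) → G.Bypassed m N g x := by
  obtain ⟨N, f, hf⟩ := (hk.connected (by omega)).exists_isLongest
    fun v => by have := hd v; omega
  refine ⟨N, f, hf, ?_, fun g hg x hx =>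
    ⟨hg, hx, fun y z hy hz => hg.off_indep hE hk hy hz, hE, hm, ?_⟩⟩
  · by_contra! hcon
    refine hham (hf.toIsCyc.isHamiltonian (le_antisymm hf.toIsCyc.le_card ?_))
    have hsurj : ∀ v, v ∈ (seg f 0 (N - 1)).toFinset := by
      intro v
      obtain ⟨i, rfl⟩ := hcon v
      obtain ⟨s, h0, h1, hs⟩ := hf.toIsCyc.exists_mem_Ico 0 i
      rw [List.mem_toFinset, mem_seg]
      exact ⟨s, h0, by omega, by simpa using hs 0⟩
    have h1 : Finset.univ ⊆ (seg f 0 (N - 1)).toFinset := fun v _ => hsurj v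
    have h2 := (Finset.card_le_card h1).trans (List.toFinset_card_le _)
    rw [length_seg, Finset.card_univ] at h2
    omega
  · have := hd x
    rwa [← G.card_neighborSet_eq_degree, ← Nat.card_eq_fintype_card, Nat.card_coe_set_eq] at this

end SimpleGraph

/-! ### The exceptional case m = 2, d = 3 and the Petersen graph. -/

namespace SimpleGraph

variable {V : Type*} {G : SimpleGraph V}

variable {m N : ℕ} {f : ℤ → V} {x v w : V} {e t : ℤ}

lemma freeAt_neg : G.FreeAt (fun i => f (-i)) x 1 v ↔ G.FreeAt f x (-1) v := by
  refine and_congr_right fun _ => ⟨fun H t ht => ?_, fun H t ht => ?_⟩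
  · have := H (-t) (by simpa using ht)
    simpa [add_comm, sub_eq_add_neg] using this
  · have := H (-t) ht
    simpa [add_comm, sub_eq_add_neg] using this

namespace Bypassed

lemma neg (h : G.Bypassed m N f x) : G.Bypassed m N (fun i => f (-i)) x where
  longest := h.longest.neg
  off i := h.off _
  off_indep y z hy hz := h.off_indep y z (fun i => by simpa using hy (-i))
    (fun i => by simpa using hz (-i))
  edge := h.edge
  one_le := h.one_le
  deg := h.deg

/-- The bounds d - m = 1 and d + 1 - m = 2 are attained: the contacts split exactly into {0}, for `f
0`, and the other two, for `f (N - 1)`. -/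
lemma cross_zero (h : G.Bypassed 2 N f x) (hd : (G.neighborSet x).ncard = 3)
    (h0 : G.Adj x (f 0)) (hz : ¬ G.FreeAt f x 1 (f (N - 1))) :
    (∀ s ∈ G.contacts N f x, s ≠ 0 → G.Adj (f (N - 1)) (f (s + 1)) ∧ ¬ G.Adj (f 0) (f (s + 1))) ∧
      ¬ G.Adj (f (N - 1)) (f 1) := by
  classical
  have h3 := h.longest.three_le
  have hs : ¬ G.FreeAt f x 1 (f 0) := fun hf => hf.1 h0.symm
  have c1 := h.card_sideNbrs_of_adj (Or.inl rfl) h0.symm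
  have c2 := h.card_sideNbrs (Or.inl rfl) hz (h.not_adj_last hs)
  set A := G.sideNbrs N f x 1 (f 0) with hA
  set Z := G.sideNbrs N f x 1 (f (N - 1)) with hZ
  have hlt : ∀ {s t}, s ∈ A → t ∈ Z → s < t := fun hs' ht => h.lt_of_mem_sideNbrs hs ht hs'
  have d1 : Disjoint A Z := Finset.disjoint_left.2 fun t hB hC => (hlt hB hC).false
  have hsub : A ∪ Z ⊆ G.contacts N f x := Finset.union_subset sideNbrs_subset sideNbrs_subset
  have hcard := Finset.card_le_card hsub
  rw [Finset.card_union_of_disjoint d1, h.card_contacts] at hcard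
  have hc0 : (0 : ℤ) ∈ G.contacts N f x := mem_contacts.2 ⟨⟨le_rfl, by omega⟩, h0⟩
  have h0A : (0 : ℤ) ∈ A := by
    rw [hA, mem_sideNbrs]
    exact ⟨hc0, h.longest.adj 0⟩
  have hA1 : ∀ s ∈ A, s = 0 := fun s hs' => Finset.card_le_one.1 (by omega) s hs' 0 h0A
  have heq : A ∪ Z = G.contacts N f x := by
    refine Finset.eq_of_subset_of_card_le hsub ?_
    rw [Finset.card_union_of_disjoint d1, h.card_contacts]; omega
  refine ⟨fun s hs' hs0 => ⟨?_, fun hadj => hs0 (hA1 s ?_)⟩, fun hadj => ?_⟩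
  · rw [← heq, Finset.mem_union] at hs'
    rcases hs' with hs' | hs'
    · exact absurd (hA1 s hs') hs0
    · exact (mem_sideNbrs.1 hs').2
  · rw [hA, mem_sideNbrs]; exact ⟨hs', hadj⟩
  · refine (hlt h0A (t := 0) ?_).false
    rw [hZ, mem_sideNbrs]
    exact ⟨hc0, hadj⟩

lemma cross (h : G.Bypassed 2 N f x) (hd : (G.neighborSet x).ncard = 3)
    (h0 : G.Adj x (f t)) (hz : ¬ G.FreeAt f x 1 (f (t - 1))) :
    (∀ s, G.Adj x (f s) → f s ≠ f t → G.Adj (f (t - 1)) (f (s + 1)) ∧ ¬ G.Adj (f t) (f (s + 1))) ∧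
      ¬ G.Adj (f (t - 1)) (f (t + 1)) := by
  have hlast : f ((N : ℤ) - 1 + t) = f (t - 1) := h.longest.toIsCyc.eq_of (by omega)
  have := (h.shift t).cross_zero hd (by simpa using h0) (by rw [freeAt_shift, hlast]; exact hz)
  simp only [zero_add] at this
  rw [hlast] at this
  refine ⟨fun s hs hst => ?_, by rw [add_comm t 1]; exact this.2⟩
  obtain ⟨r, hr, hrs⟩ := (h.shift t).exists_contact (t := s - t) (by simpa using hs)
  have h1 := hrs 1
  have h2 := hrs 0
  simp only [add_zero, sub_add_cancel, show s - t + 1 + t = s + 1 by ring] at h1 h2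
  have := this.1 r hr (by rintro rfl; exact hst (by rw [← h2, zero_add]))
  rwa [h1] at this

lemma cross_neg (h : G.Bypassed 2 N f x) (hd : (G.neighborSet x).ncard = 3)
    (h0 : G.Adj x (f t)) (hz : ¬ G.FreeAt f x (-1) (f (t + 1))) :
    ∀ s, G.Adj x (f s) → f s ≠ f t → G.Adj (f (t + 1)) (f (s - 1)) := by
  intro s hs hst
  have := (h.neg.cross hd (t := -t) (by simpa using h0)
    (by rw [freeAt_neg]; simpa [add_comm] using hz)).1 (-s) (by simpa using hs) (by simpa using hst)
  simpa [add_comm, sub_eq_add_neg] using this.1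

lemma exists_contacts (h : G.Bypassed m N f x) (hd : (G.neighborSet x).ncard = 3) (r s : ℤ) :
    ∃ t, G.Adj x (f t) ∧ f t ≠ f r ∧ f t ≠ f s := by
  classical
  have hc : 2 < (G.contacts N f x).card := by rw [h.card_contacts]; omega
  by_contra! hcon
  have hsub : (G.contacts N f x).image (fun t => f (t + 0)) ⊆ {f r, f s} := by
    intro v hv
    obtain ⟨t, ht, rfl⟩ := Finset.mem_image.1 hv
    rw [add_zero, Finset.mem_insert, Finset.mem_singleton]
    by_cases h1 : f t = f r
    · exact Or.inl h1
    · exact Or.inr (hcon t (mem_contacts.1 ht).2 h1)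
  have := Finset.card_le_card hsub
  rw [Finset.card_image_of_injOn (h.side_injOn 0)] at this
  have := Finset.card_le_two (a := f r) (b := f s)
  omega

/-- Take a third contact `s`. The predecessor of `t` sees `f (s + 1)`, so the mirrored crossing
property at `s` makes `f (s + 1)` see `f (r - 1)`. -/
lemma not_freeAt_pred_of_exists (h : G.Bypassed 2 N f x) (hd : (G.neighborSet x).ncard = 3)
    (h0 : G.Adj x (f t)) (hz : ¬ G.FreeAt f x 1 (f (t - 1))) {r : ℤ} (hr : G.Adj x (f r)) :
    ¬ G.FreeAt f x 1 (f (r - 1)) := by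
  obtain ⟨s, hs, hst, hsr⟩ := h.exists_contacts hd t r
  have h1 := ((h.cross hd h0 hz).1 s hs hst).1
  have h2 : ¬ G.FreeAt f x (-1) (f (s + 1)) := fun hf => hf.2 t h0 h1.symm
  have h3 := h.cross_neg hd hs h2 r hr hsr.symm
  exact fun hf => hf.2 s hs h3.symm

/-- A successor of a neighbour of `x` lies off another longest cycle. -/
lemma exists_isLongest_off_succ (h : G.Bypassed m N f x) (h0 : G.Adj x (f t)) :
    ∃ g, G.IsLongest N g ∧ ∀ i, g i ≠ f (t + 1) := by
  have h' := h.shift t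
  set f' := fun i => f (i + t) with hf'
  have h3 := h.longest.three_le
  have h0' : G.Adj x (f' 0) := by simpa [hf'] using h0
  have hs : ¬ G.FreeAt f' x 1 (f' 0) := fun hf => hf.1 h0'.symm
  have hadj : G.Adj (f' 2) (f' 1) := (h'.longest.adj 1).symm
  obtain ⟨L, hL, hLp⟩ : ∃ L, G.IsSeg L (f' 0) (f' (N - 1)) ∧
      (f' (0 + 1) :: L).Perm (x :: seg f' 0 (N - 1)) := by
    by_cases hw : G.Adj x (f' 2)
    · exact h'.longest.exists_reroute_of_adj le_rfl (by omega) h0' hw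
    · have hc := h'.card_sideNbrs (v := f' 2) (Or.inl rfl) (fun hf => hf.2 0 h0' hadj)
        (fun h' => hw h'.symm)
      have hd := h.deg
      have h1 := h.one_le
      obtain ⟨r, hr, hrt⟩ := Finset.exists_mem_ne
        (show 1 < (G.sideNbrs N f' x 1 (f' 2)).card by omega) 0
      rw [mem_sideNbrs] at hr
      have hrm := mem_contacts.1 hr.1
      have hrlt := h'.contact_lt hs hr.1
      refine h'.longest.exists_reroute le_rfl (by omega) hrm.1.1 (by omega) hrt.symm ?_ h0' hrm.2
        hr.2
      rintro rfl
      exact h'.longest.not_adj_succ h'.off h0' hrm.2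
  have hnd : (f' (0 + 1) :: L).Nodup := by
    rw [hLp.nodup_iff, List.nodup_cons]
    refine ⟨fun hx => ?_, h'.longest.nodup_seg (by omega)⟩
    obtain ⟨i, -, -, hi⟩ := mem_seg.1 hx
    exact h'.off i hi
  have hlen := hLp.length_eq
  rw [List.length_cons, List.length_cons, length_seg] at hlen
  have hlen : L.length = N := by omega
  rw [List.nodup_cons] at hnd
  -- The rerouted path closes up along the edge from `f (N - 1)` to `f 0`, with x in place of `f (t
  -- + 1)`.
  obtain ⟨g, hg, hmem⟩ := hL.exists_isCyc h'.longest.adj_period hnd.2 (by omega)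
  rw [hlen] at hg
  refine ⟨g, ⟨hg, h.longest.le⟩, fun i hi => hnd.1 ((hmem _).2 ⟨i, ?_⟩)⟩
  rw [hi, add_comm]; simp [hf']

end Bypassed

/-- The situation in which every longest cycle has length `N` and is bypassed, for `m = 2`. -/
structure Exceptional (G : SimpleGraph V) (N : ℕ) (f : ℤ → V) (x : V) : Prop
    extends G.Bypassed 2 N f x where
  three : ∀ g, G.IsLongest N g → ∀ y, (∀ i, g i ≠ y) → (G.neighborSet y).ncard = 3
  not_free : ∀ t, G.Adj x (f t) → ¬ G.FreeAt f x 1 (f (t - 1))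

namespace Exceptional

lemma ncard_eq (h : G.Exceptional N f x) : (G.neighborSet x).ncard = 3 :=
  h.three f h.longest x h.off

lemma shift (h : G.Exceptional N f x) (k : ℤ) : G.Exceptional N (fun i => f (i + k)) x where
  toBypassed := h.toBypassed.shift k
  three := h.three
  not_free t ht := by
    have := h.not_free (t + k) ht
    rwa [Bypassed.freeAt_shift, show t - 1 + k = t + k - 1 by ring]

lemma adj_cross (h : G.Exceptional N f x) {s : ℤ} (ht : G.Adj x (f t)) (hs : G.Adj x (f s))
    (hst : f s ≠ f t) : G.Adj (f (t - 1)) (f (s + 1)) :=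
  ((h.cross h.ncard_eq ht (h.not_free t ht)).1 s hs hst).1

/-- The vertex `f (t + 1)` lies off another longest cycle, so it has degree 3. It sees `f t`, `f (t
+ 2)` and the predecessors of the other two contacts, so `f (t + 2)` must be one of these
predecessors. -/
lemma adj_add_three (h : G.Exceptional N f x) (ht : G.Adj x (f t)) : G.Adj x (f (t + 3)) := by
  classical
  have h3 := h.longest.three_le
  obtain ⟨g, hg, hoff⟩ := h.exists_isLongest_off_succ ht
  have hu := h.three g hg _ hoff
  obtain ⟨s, hs, hst, -⟩ := h.exists_contacts h.ncard_eq t t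
  obtain ⟨r, hr, hrt, hrs⟩ := h.exists_contacts h.ncard_eq t s
  have hne : ∀ q, G.Adj x (f q) → f (q - 1) ≠ f t := by
    intro q hq heq
    refine h.longest.not_adj_succ h.off (t := q - 1) (by rw [heq]; exact ht) ?_
    rwa [sub_add_cancel]
  have hsr : f (s - 1) ≠ f (r - 1) := by
    intro heq
    apply hrs
    rw [h.longest.eq_iff] at heq ⊢
    rw [show r - s = -(s - 1 - (r - 1)) by ring]
    exact (dvd_neg).2 heq
  have h2t : f (t + 2) ≠ f t := (h.longest.toIsCyc.ne_of (by omega) (by omega)).symm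
  have key : ∀ q, G.Adj x (f q) → f (t + 2) = f (q - 1) → G.Adj x (f (t + 3)) := by
    intro q hq heq
    rw [h.longest.eq_iff] at heq
    have : f (t + 3) = f q := by
      rw [h.longest.eq_iff, show t + 3 - q = t + 2 - (q - 1) by ring]; exact heq
    rwa [this]
  by_contra hcon
  have h2s : f (t + 2) ≠ f (s - 1) := fun heq => hcon (key s hs heq)
  have h2r : f (t + 2) ≠ f (r - 1) := fun heq => hcon (key r hr heq)
  have hfin : (G.neighborSet (f (t + 1))).Finite := Set.finite_of_ncard_ne_zero (by omega)
  have hsub : (({f t, f (t + 2), f (s - 1), f (r - 1)} : Finset V) : Set V) ⊆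
      G.neighborSet (f (t + 1)) := by
    intro v hv
    simp only [Finset.coe_insert, Finset.coe_singleton, Set.mem_insert_iff,
      Set.mem_singleton_iff] at hv
    rw [mem_neighborSet]
    rcases hv with rfl | rfl | rfl | rfl
    · exact (h.longest.adj t).symm
    · have := h.longest.adj (t + 1)
      rwa [show t + 1 + 1 = t + 2 by ring] at this
    · exact (h.adj_cross hs ht hst.symm).symm
    · exact (h.adj_cross hr ht hrt.symm).symm
  have hcard := Set.ncard_le_ncard hsub hfin
  rw [Set.ncard_coe_finset, Finset.card_insert_of_notMem, Finset.card_insert_of_notMem,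
    Finset.card_pair hsr, hu] at hcard
  · omega
  · simpa using ⟨h2s, h2r⟩
  · simpa using ⟨h2t.symm, (hne s hs).symm, (hne r hr).symm⟩

lemma adj_mul_three (h : G.Exceptional N f x) (h0 : G.Adj x (f 0)) (k : ℕ) :
    G.Adj x (f (3 * k)) := by
  induction k with
  | zero => simpa using h0
  | succ k ih =>
    have := h.adj_add_three ih
    rwa [show (3 : ℤ) * k + 3 = 3 * (k + 1 : ℕ) by push_cast; ring] at this

lemma three_dvd (h : G.Exceptional N f x) (h0 : G.Adj x (f 0)) (ht : 0 ≤ t)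
    (hxt : G.Adj x (f t)) : (3 : ℤ) ∣ t := by
  have hk := h.adj_mul_three h0 (t / 3).toNat
  have hk' := h.adj_mul_three h0 ((t / 3).toNat + 1)
  by_contra hcon
  have : t = 3 * (t / 3).toNat + 1 ∨ t + 1 = 3 * ((t / 3).toNat + 1 : ℕ) := by omega
  rcases this with heq | heq
  · rw [heq] at hxt
    exact h.longest.not_adj_succ h.off hk hxt
  · rw [← heq] at hk'
    exact h.longest.not_adj_succ h.off hxt hk'

/-- The contacts are exactly the multiples of 3 within a period, and there are three of them. -/
lemma eq_nine (h : G.Exceptional N f x) (h0 : G.Adj x (f 0)) : N = 9 := by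
  have hN : (3 : ℤ) ∣ N := h.three_dvd h0 (by omega) (by
    rwa [h.longest.toIsCyc.eq_of (i := (N : ℤ)) (j := 0) (by omega)])
  have hc := h.card_contacts
  rw [h.ncard_eq] at hc
  have h9 : ¬ 9 < N := by
    intro hlt
    have hsub : ({0, 3, 6, 9} : Finset ℤ) ⊆ G.contacts N f x := by
      intro t ht
      simp only [Finset.mem_insert, Finset.mem_singleton] at ht
      have h1 := h.adj_mul_three h0 1
      have h2 := h.adj_mul_three h0 2
      have h3 := h.adj_mul_three h0 3
      norm_num at h1 h2 h3
      rw [mem_contacts]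
      rcases ht with rfl | rfl | rfl | rfl <;> refine ⟨by omega, by assumption⟩
    have := Finset.card_le_card hsub
    rw [hc] at this
    exact absurd this (by decide)
  have h6 : ¬ N ≤ 6 := by
    intro hle
    have hsub : G.contacts N f x ⊆ ({0, 3} : Finset ℤ) := by
      intro t ht
      rw [mem_contacts] at ht
      have := h.three_dvd h0 ht.1.1 ht.2
      simp only [Finset.mem_insert, Finset.mem_singleton]
      omega
    have := Finset.card_le_card hsub
    rw [hc] at this
    exact absurd this (by decide)
  omega

/-- A second vertex `y` off the cycle would see both `f (-1)` and `f 0`, each forced by `EdgeBound`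
with a triple containing `y`. Then `y` could be inserted. -/
lemma eq_of_off (h : G.Exceptional N f x) (h0 : G.Adj x (f 0)) {y : V} (hy : ∀ i, f i ≠ y) :
    y = x := by
  classical
  by_contra hyx
  obtain rfl := h.eq_nine h0
  have hfree := h.freeAt_of_off hy
  have hxy : ¬ G.Adj x y := h.off_indep x y h.off hy
  have h3 : G.Adj x (f 3) := by simpa using h.adj_mul_three h0 1
  have h6 : G.Adj x (f 6) := by simpa using h.adj_mul_three h0 2
  have hne : ∀ i j : ℤ, i < j → j < i + 9 → f i ≠ f j := fun i j h1 h2 =>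
    h.longest.toIsCyc.ne_of h1 h2
  have hc := h.cross h.ncard_eq h0 (h.not_free 0 h0)
  have hc3 := hc.1 3 h3 (hne 0 3 (by omega) (by omega)).symm
  have hc6 := hc.1 6 h6 (hne 0 6 (by omega) (by omega)).symm
  have hss : ∀ {s t}, G.Adj x (f s) → G.Adj x (f t) → ¬ G.Adj (f (s + 1)) (f (t + 1)) :=
    fun hs ht => h.not_adj_side_side (Or.inl rfl) hs ht
  have hxs : ∀ {s}, G.Adj x (f s) → ¬ G.Adj x (f (s + 1)) := fun hs =>
    h.not_adj_side (Or.inl rfl) hs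
  have hz : G.Adj y (f (0 - 1)) := by
    by_contra hcon
    have := h.edge (f (0 - 1)) (f (3 + 1)) hc3.1 {x, f (0 + 1), y} ?_ ?_
    · rw [Finset.card_eq_three.2 ⟨x, f (0 + 1), y, (h.off _).symm, Ne.symm hyx, hy _, rfl⟩] at this
      omega
    · intro a ha b hb
      simp only [Finset.mem_insert, Finset.mem_singleton] at ha hb
      rcases ha with rfl | rfl | rfl <;> rcases hb with rfl | rfl | rfl
      all_goals first
        | exact G.loopless.irrefl _
        | exact hxs h0
        | exact hxy
        | exact fun h' => hxs h0 h'.symm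
        | exact fun h' => hxy h'.symm
        | exact hfree.2 0 h0
        | exact fun h' => hfree.2 0 h0 h'.symm
    · intro a ha
      simp only [Finset.mem_insert, Finset.mem_singleton] at ha
      rcases ha with rfl | rfl | rfl
      · refine ⟨fun h' => h.not_adj_side (Or.inr rfl) h0 h'.symm, fun h' => hxs h3 h'.symm⟩
      · exact ⟨hc.2, hss h3 h0⟩
      · exact ⟨fun h' => hcon h'.symm, fun h' => hfree.2 3 h3 h'.symm⟩
  have ha : G.Adj y (f 0) := by
    by_contra hcon
    have := h.edge (f 0) x h0.symm {f (3 + 1), f (6 + 1), y} ?_ ?_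
    · rw [Finset.card_eq_three.2 ⟨_, _, _, hne _ _ (by omega) (by omega), hy _, hy _, rfl⟩] at this
      omega
    · intro a ha b hb
      simp only [Finset.mem_insert, Finset.mem_singleton] at ha hb
      rcases ha with rfl | rfl | rfl <;> rcases hb with rfl | rfl | rfl
      all_goals first
        | exact G.loopless.irrefl _
        | exact hss h3 h6
        | exact hss h6 h3
        | exact hfree.2 3 h3
        | exact fun h' => hfree.2 3 h3 h'.symm
        | exact hfree.2 6 h6
        | exact fun h' => hfree.2 6 h6 h'.symm
    · intro a ha
      simp only [Finset.mem_insert, Finset.mem_singleton] at ha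
      rcases ha with rfl | rfl | rfl
      · exact ⟨hc3.2, hxs h3⟩
      · exact ⟨hc6.2, hxs h6⟩
      · exact ⟨fun h' => hcon h'.symm, hxy⟩
  exact h.longest.not_adj_succ hy hz (by simpa using ha)

lemma ncard_zero (h : G.Exceptional N f x) (h0 : G.Adj x (f 0)) :
    (G.neighborSet (f 0)).ncard = 3 := by
  obtain rfl := h.eq_nine h0
  have h3 : G.Adj x (f 3) := by simpa using h.adj_mul_three h0 1
  have h6 : G.Adj x (f 6) := by simpa using h.adj_mul_three h0 2
  have hne : ∀ i j : ℤ, i < j → j < i + 9 → f i ≠ f j := fun i j h1 h2 =>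
    h.longest.toIsCyc.ne_of h1 h2
  have h84 : G.Adj (f 8) (f 4) := by
    have := h.adj_cross h0 h3 (hne 0 3 (by omega) (by omega)).symm
    rwa [h.longest.toIsCyc.eq_of (i := 0 - 1) (j := 8) (by simp)] at this
  have h51 : G.Adj (f 5) (f 1) := by
    simpa using h.adj_cross h6 h0 (hne 0 6 (by omega) (by omega))
  have hs : ∀ a b : ℤ, a ≤ b → G.IsSeg (seg f a b) (f a) (f b) := fun a b hab =>
    isSeg_seg h.longest.adj hab
  -- The 9-cycle x, 6, 7, 8, 4, 5, 1, 2, 3 omits `f 0`, so `f 0` has degree 3.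
  have hL := (((hs 6 8 (by omega)).append (hs 4 5 (by omega)) h84).append (hs 1 3 (by omega))
    h51).cons h6
  have hp : (seg f 6 8 ++ seg f 4 5 ++ seg f 1 3).Perm (seg f 1 8) := by
    classical
    rw [← seg_append f (a := 1) (b := 3) (c := 8) (by omega) (by omega),
      ← seg_append f (a := 3 + 1) (b := 5) (c := 8) (by omega) (by omega)]
    simp only [List.perm_iff_count, List.count_append]
    intro; norm_num; omega
  have hnd : (x :: (seg f 6 8 ++ seg f 4 5 ++ seg f 1 3)).Nodup := by
    rw [List.nodup_cons, hp.nodup_iff, hp.mem_iff]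
    refine ⟨fun hx => ?_, h.longest.nodup_seg (by norm_num)⟩
    obtain ⟨i, -, -, hi⟩ := mem_seg.1 hx
    exact h.off i hi
  have hlen : (x :: (seg f 6 8 ++ seg f 4 5 ++ seg f 1 3)).length = 9 := by
    rw [List.length_cons, hp.length_eq, length_seg]; rfl
  obtain ⟨g, hg, hmem⟩ := hL.exists_isCyc h3.symm hnd (by omega)
  rw [hlen] at hg
  refine h.three g ⟨hg, h.longest.le⟩ _ fun i hi => ?_
  have := (hmem (f 0)).2 ⟨i, hi⟩
  rw [List.mem_cons, hp.mem_iff] at this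
  rcases this with hx | hx
  · exact h.off 0 hx
  · obtain ⟨j, hj, hj', hji⟩ := mem_seg.1 hx
    exact hne 0 j (by omega) (by omega) hji.symm

lemma ncard_cycle (h : G.Exceptional N f x) (h0 : G.Adj x (f 0)) (k : ℕ) :
    (G.neighborSet (f k)).ncard = 3 := by
  have key : ∀ t, G.Adj x (f t) → (G.neighborSet (f t)).ncard = 3 ∧
      (G.neighborSet (f (t + 1))).ncard = 3 ∧ (G.neighborSet (f (t - 1))).ncard = 3 := by
    intro t ht
    refine ⟨?_, ?_, ?_⟩
    · simpa using (h.shift t).ncard_zero (by simpa using ht)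
    · obtain ⟨g, hg, hoff⟩ := h.exists_isLongest_off_succ ht
      exact h.three g hg _ hoff
    · obtain ⟨g, hg, hoff⟩ := h.toBypassed.neg.exists_isLongest_off_succ (t := -t)
        (by simpa using ht)
      refine h.three g hg _ fun i hi => hoff i ?_
      rw [hi]; congr 1; ring
  have h1 := h.adj_mul_three h0 (k / 3)
  have h2 := h.adj_mul_three h0 (k / 3 + 1)
  have : k % 3 = 0 ∨ k % 3 = 1 ∨ k % 3 = 2 := by omega
  rcases this with hk | hk | hk
  · have := (key _ h1).1
    rwa [show (3 : ℤ) * (k / 3 : ℕ) = k by omega] at this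
  · have := (key _ h1).2.1
    rwa [show (3 : ℤ) * (k / 3 : ℕ) + 1 = k by omega] at this
  · have := (key _ h2).2.2
    rwa [show (3 : ℤ) * (k / 3 + 1 : ℕ) - 1 = k by omega] at this

end Exceptional

/-- The vertices of the Petersen graph other than `{0, 1}`, along a cycle. -/
def petersenCycle : Fin 9 → Finset (Fin 5) :=
  ![{2, 3}, {0, 4}, {1, 3}, {2, 4}, {0, 3}, {1, 2}, {3, 4}, {0, 2}, {1, 4}]

/-- The vertices of the Petersen graph. -/
def petersenVertex : Option (Fin 9) → {s : Finset (Fin 5) // s.card = 2}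
  | none => ⟨{0, 1}, by decide⟩
  | some i => ⟨petersenCycle i, by revert i; decide⟩

lemma petersenVertex_bijective : Function.Bijective petersenVertex := by
  constructor
  · decide
  · decide

lemma petersenCycle_adj : ∀ i j : Fin 9, Disjoint (petersenCycle i) (petersenCycle j) → i < j →
    j.val = i.val + 1 ∨ (i, j) ∈ [((0 : Fin 9), (8 : Fin 9)), (4, 8), (2, 7), (1, 5)] := by
  decide

lemma petersenCycle_adj_none :
    ∀ i : Fin 9, Disjoint {0, 1} (petersenCycle i) → i = 0 ∨ i = 3 ∨ i = 6 := by
  decide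

lemma petersen_degree : ∀ a : Option (Fin 9), (Finset.univ.filter fun b =>
    Disjoint (petersenVertex a).1 (petersenVertex b).1).card = 3 := by
  decide

namespace Exceptional

/-- The labelling of the vertices of `G` by those of the Petersen graph. -/
def label (f : ℤ → V) (x : V) : Option (Fin 9) → V
  | none => x
  | some i => f i.val

lemma label_bijective (h : G.Exceptional N f x) (h0 : G.Adj x (f 0)) :
    Function.Bijective (label f x) := by
  obtain rfl := h.eq_nine h0
  constructor
  · rintro (_ | i) (_ | j) hij
    · rfl
    · exact absurd hij.symm (h.off _)
    · exact absurd hij (h.off _)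
    · congr 1
      simp only [label] at hij
      rcases lt_trichotomy i j with hlt | heq | hlt
      · exact absurd hij (h.longest.toIsCyc.ne_of (by omega) (by omega))
      · exact heq
      · exact absurd hij.symm (h.longest.toIsCyc.ne_of (by omega) (by omega))
  · intro v
    by_cases hv : ∀ i, f i ≠ v
    · exact ⟨none, (h.eq_of_off h0 hv).symm⟩
    · push Not at hv
      obtain ⟨i, rfl⟩ := hv
      obtain ⟨s, hs, hs', hsi⟩ := h.longest.toIsCyc.exists_mem_Ico 0 i
      refine ⟨some ⟨s.toNat, by omega⟩, ?_⟩
      have := hsi 0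
      rw [add_zero, add_zero] at this
      rw [← this]
      simp only [label]
      congr 1
      omega

lemma adj_label (h : G.Exceptional N f x) (h0 : G.Adj x (f 0)) {a b : Option (Fin 9)}
    (hab : petersenGraph.Adj (petersenVertex a) (petersenVertex b)) :
    G.Adj (label f x a) (label f x b) := by
  obtain rfl := h.eq_nine h0
  have h3 : G.Adj x (f 3) := by simpa using h.adj_mul_three h0 1
  have h6 : G.Adj x (f 6) := by simpa using h.adj_mul_three h0 2
  have hne : ∀ i j : ℤ, i < j → j < i + 9 → f i ≠ f j := fun i j h1 h2 =>
    h.longest.toIsCyc.ne_of h1 h2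
  have h84 : G.Adj (f 4) (f 8) := by
    have := h.adj_cross h0 h3 (hne 0 3 (by omega) (by omega)).symm
    rw [h.longest.toIsCyc.eq_of (i := 0 - 1) (j := 8) (by simp)] at this
    exact this.symm
  have h27 : G.Adj (f 2) (f 7) := by
    simpa using h.adj_cross h3 h6 (hne 3 6 (by omega) (by omega)).symm
  have h51 : G.Adj (f 1) (f 5) := by
    simpa using (h.adj_cross h6 h0 (hne 0 6 (by omega) (by omega))).symm
  have h08 : G.Adj (f 0) (f 8) := by simpa using h.longest.adj_period.symm
  have hnone : ∀ j, petersenGraph.Adj (petersenVertex none) (petersenVertex (some j)) →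
      G.Adj x (f j.val) := by
    intro j hj
    rcases petersenCycle_adj_none j hj with rfl | rfl | rfl
    · exact h0
    · exact h3
    · exact h6
  have hsome : ∀ i j : Fin 9, Disjoint (petersenCycle i) (petersenCycle j) → i < j →
      G.Adj (f i.val) (f j.val) := by
    intro i j hij hlt
    rcases petersenCycle_adj i j hij hlt with heq | hmem
    · rw [heq]
      exact_mod_cast h.longest.adj i.val
    · simp only [List.mem_cons, Prod.mk.injEq, List.not_mem_nil, or_false] at hmem
      rcases hmem with ⟨rfl, rfl⟩ | ⟨rfl, rfl⟩ | ⟨rfl, rfl⟩ | ⟨rfl, rfl⟩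
      · exact h08
      · exact h84
      · exact h27
      · exact h51
  rcases a with _ | i <;> rcases b with _ | j
  · exact absurd rfl hab.ne
  · exact hnone j hab
  · exact (hnone i hab.symm).symm
  · rcases lt_trichotomy i j with hlt | rfl | hlt
    · exact hsome i j hab hlt
    · exact absurd rfl hab.ne
    · exact (hsome j i hab.symm hlt).symm

lemma ncard_label (h : G.Exceptional N f x) (h0 : G.Adj x (f 0)) (a : Option (Fin 9)) :
    (G.neighborSet (label f x a)).ncard = 3 := by
  rcases a with _ | i
  · exact h.ncard_eq
  · exact h.ncard_cycle h0 i.val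

theorem nonempty_iso (h : G.Exceptional N f x) : Nonempty (G ≃g petersenGraph) := by
  classical
  obtain ⟨t, ht, -⟩ := h.exists_contacts h.ncard_eq 0 0
  replace h := h.shift t
  have h0 : G.Adj x ((fun i => f (i + t)) 0) := by simpa using ht
  generalize (fun i => f (i + t)) = f' at h h0
  have hb := h.label_bijective h0
  refine ⟨((Equiv.ofBijective _ hb).symm.trans
    (Equiv.ofBijective _ petersenVertex_bijective)), ?_⟩
  -- Petersen edges map to edges of G and both graphs are cubic, so neighbourhoods coincide and no
  -- further edge exists.
  have key : ∀ a b, petersenGraph.Adj (petersenVertex a) (petersenVertex b) ↔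
      G.Adj (label f' x a) (label f' x b) := by
    intro a b
    refine ⟨h.adj_label h0, fun hab => ?_⟩
    set P := Finset.univ.filter fun b => Disjoint (petersenVertex a).1 (petersenVertex b).1 with hP
    have hsub : ((P.image (label f' x) : Finset V) : Set V) ⊆ G.neighborSet (label f' x a) := by
      intro v hv
      obtain ⟨c, hc, rfl⟩ := Finset.mem_image.1 (Finset.mem_coe.1 hv)
      exact h.adj_label h0 (Finset.mem_filter.1 hc).2
    have heq := Set.eq_of_subset_of_ncard_le hsub (by
      rw [Set.ncard_coe_finset, Finset.card_image_of_injective _ hb.1, h.ncard_label h0]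
      exact (petersen_degree a).ge) (Set.finite_of_ncard_ne_zero (by rw [h.ncard_label h0]; omega))
    have hmem : label f' x b ∈ G.neighborSet (label f' x a) := hab
    rw [← heq] at hmem
    obtain ⟨c, hc, hcb⟩ := Finset.mem_image.1 (Finset.mem_coe.1 hmem)
    rw [← hb.1 hcb]
    exact (Finset.mem_filter.1 hc).2
  intro v w
  obtain ⟨a, rfl⟩ := hb.2 v
  obtain ⟨b, rfl⟩ := hb.2 w
  simpa [Equiv.ofBijective_symm_apply_apply] using key a b

end Exceptional

end SimpleGraph

/-! ### Forbidden subgraphs, connectivity, toughness and the final assembly. -/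

namespace SimpleGraph

variable {V : Type*} {G : SimpleGraph V} {k m : ℕ}

/-- In a `(K₂ ∪ kK₁)`-free graph an independent set without neighbours on some edge has fewer than
`k` elements. -/
lemma IsInducedFree.card_lt (h : G.IsInducedFree (edgeUnionIsolated k)) {y z : V}
    (hyz : G.Adj y z) {S : Finset V} (hS : ∀ a ∈ S, ∀ b ∈ S, ¬ G.Adj a b)
    (hyS : ∀ s ∈ S, ¬ G.Adj y s ∧ ¬ G.Adj z s) : S.card < k := by
  by_contra! hk
  refine h ⟨?_⟩
  let e : Fin k → V := fun i => (S.equivFin.symm (Fin.castLE hk i) : V)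
  have he : ∀ i, e i ∈ S := fun i => (S.equivFin.symm (Fin.castLE hk i)).2
  have hinj : Function.Injective e := by
    intro i j hij
    have := S.equivFin.symm.injective (Subtype.ext hij)
    exact Fin.castLE_injective hk this
  have hey : ∀ i, e i ≠ y := fun i hi => (hyS _ (he i)).2 (hi ▸ hyz.symm)
  have hez : ∀ i, e i ≠ z := fun i hi => (hyS _ (he i)).1 (hi ▸ hyz)
  refine ⟨⟨Sum.elim ![y, z] e, ?_⟩, ?_⟩
  · refine Function.Injective.sumElim ?_ hinj ?_
    · intro i j hij
      fin_cases i <;> fin_cases j <;> simp_all [hyz.ne, hyz.ne']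
    · intro i j
      fin_cases i
      · exact (hey j).symm
      · exact (hez j).symm
  · intro a b
    rcases a with i | i <;> rcases b with j | j
    · fin_cases i <;> fin_cases j <;> simp [edgeUnionIsolated, hyz, hyz.symm]
    · fin_cases i
      · simpa [edgeUnionIsolated] using (hyS _ (he j)).1
      · simpa [edgeUnionIsolated] using (hyS _ (he j)).2
    · fin_cases j
      · simpa [edgeUnionIsolated] using fun h' : G.Adj (e i) y => (hyS _ (he i)).1 h'.symm
      · simpa [edgeUnionIsolated] using fun h' : G.Adj (e i) z => (hyS _ (he i)).2 h'.symm
    · simpa [edgeUnionIsolated] using hS _ (he i) _ (he j)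

lemma IsInducedFree.edgeBound (h : G.IsInducedFree (edgeUnionIsolated (m + 1))) :
    G.EdgeBound m :=
  fun _ _ hyz _ hS hyS => Nat.lt_succ_iff.1 (h.card_lt hyz hS hyS)

theorem isHamiltonian_or_petersen [Fintype V] [DecidableEq V] [DecidableRel G.Adj] (hk : 2 ≤ k)
    (hconn : G.IsKConnected k) (hfree : G.IsInducedFree (edgeUnionIsolated k))
    (hd : ∀ v, 3 * (k - 1) ≤ 2 * G.degree v)
    (hα : ∀ S : Finset V, (∀ a ∈ S, ∀ b ∈ S, ¬ G.Adj a b) → 2 * S.card ≤ Fintype.card V) :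
    G.IsHamiltonian ∨ (k = 3 ∧ (∃ x, G.degree x = 3) ∧ Nonempty (G ≃g petersenGraph)) := by
  by_cases hham : G.IsHamiltonian
  · exact Or.inl hham
  right
  obtain ⟨m, rfl⟩ : ∃ m, k = m + 1 := ⟨k - 1, by omega⟩
  obtain ⟨N, f, hf, ⟨x, hx⟩, hall⟩ := exists_bypassed (m := m) (by omega) hfree.edgeBound hconn
    (by simpa using hd) hham
  have hb := hall f hf x hx
  obtain ⟨rfl, h3⟩ := hb.eq_two hα
  obtain ⟨t, ht, hz⟩ := hb.exists_not_freeAt_pred hα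
  have hexc : G.Exceptional N f x :=
    { toBypassed := hb
      three := fun g hg y hy => ((hall g hg y hy).eq_two hα).2
      not_free := fun r hr => hb.not_freeAt_pred_of_exists h3 ht hz hr }
  refine ⟨rfl, ⟨x, ?_⟩, hexc.nonempty_iso⟩
  rw [← G.card_neighborSet_eq_degree, ← Nat.card_eq_fintype_card, Nat.card_coe_set_eq, h3]

lemma two_mul_card_le [Fintype V] (h : (G.indepNum : ℝ) ≤ (Fintype.card V : ℝ) / 2)
    (S : Finset V) (hS : ∀ a ∈ S, ∀ b ∈ S, ¬ G.Adj a b) : 2 * S.card ≤ Fintype.card V := by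
  have h1 : S.card ≤ G.indepNum :=
    IsIndepSet.card_le_indepNum fun a ha b hb _ => hS a ha b hb
  have h2 : (S.card : ℝ) ≤ G.indepNum := by exact_mod_cast h1
  have : (2 * S.card : ℝ) ≤ Fintype.card V := by linarith
  exact_mod_cast this

lemma IsTough.mul_le {t : ℝ≥0} (h : G.IsTough t) (S : Finset V)
    (hS : 2 ≤ G.numComponentsDelete S) : t * G.numComponentsDelete S ≤ S.card := by
  have h1 : (t : ℝ≥0∞) ≤ (S.card : ℝ≥0∞) / (G.numComponentsDelete S : ℝ≥0∞) :=
    h.trans (iInf₂_le S hS)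
  rw [ENNReal.le_div_iff_mul_le (Or.inl (by simp; omega)) (Or.inl (by simp))] at h1
  exact_mod_cast h1

lemma isTough_one (h : ∀ S : Finset V, 2 ≤ G.numComponentsDelete S →
    G.numComponentsDelete S ≤ S.card) : G.IsTough 1 := by
  refine le_iInf₂ fun S hS => ?_
  rw [ENNReal.le_div_iff_mul_le (Or.inl (by simp; omega)) (Or.inl (by simp))]
  have := h S hS
  simp only [ENNReal.coe_one, one_mul]
  exact_mod_cast this

lemma two_le_numComponentsDelete [Finite V] {S : Finset V} {a b : V} (ha : a ∉ S) (hb : b ∉ S)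
    (hab : ¬ (G.induce {v | v ∉ S}).Reachable ⟨a, ha⟩ ⟨b, hb⟩) : 2 ≤ G.numComponentsDelete S := by
  rw [numComponentsDelete, Nat.succ_le_iff, Finite.one_lt_card_iff_nontrivial]
  exact ⟨⟨connectedComponentMk _ ⟨a, ha⟩, connectedComponentMk _ ⟨b, hb⟩,
    fun h => hab (ConnectedComponent.exact h)⟩⟩

/-- A separating set leaves at least two components, so it has at least 2t vertices. -/
lemma IsTough.isKConnected [Fintype V] {t : ℝ≥0} (h : G.IsTough t) (hk : k < Fintype.card V)
    (hkt : (k : ℝ≥0) ≤ 2 * t) : G.IsKConnected k := by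
  classical
  refine ⟨hk, fun X hX => ?_⟩
  have hne : ∃ v, v ∉ X := by
    by_contra! hcon
    have := Finset.card_le_card (fun v _ => hcon v : Finset.univ ⊆ X)
    rw [Finset.card_univ] at this
    omega
  obtain ⟨v, hv⟩ := hne
  have : Nonempty {v | v ∉ X} := ⟨⟨v, hv⟩⟩
  refine ⟨fun a b => ?_⟩
  by_contra hab
  have h2 := two_le_numComponentsDelete a.2 b.2 hab
  have h3 := h.mul_le X h2
  have h4 : (2 : ℝ≥0) ≤ G.numComponentsDelete X := by exact_mod_cast h2
  have h5 : t * 2 ≤ X.card := (mul_le_mul_right h4 t).trans h3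
  have h6 : (k : ℝ≥0) ≤ X.card := by rw [mul_comm] at h5; exact hkt.trans h5
  have : k ≤ X.card := by exact_mod_cast h6
  omega

/-- Deleting the complement of an independent set leaves isolated vertices. -/
lemma numComponentsDelete_of_indep [Fintype V] {S : Finset V}
    (hS : ∀ a ∉ S, ∀ b ∉ S, ¬ G.Adj a b) :
    G.numComponentsDelete S = Fintype.card V - S.card := by
  classical
  have hbot : G.induce {v | v ∉ S} = ⊥ := by
    ext a b
    simpa using hS a.1 a.2 b.1 b.2
  have hbij : Function.Bijective (G.induce {v | v ∉ S}).connectedComponentMk := by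
    refine ⟨fun a b hab => ?_, fun c => c.exists_rep⟩
    have := ConnectedComponent.exact hab
    rw [hbot] at this
    exact reachable_bot.1 this
  rw [numComponentsDelete, ← Nat.card_congr (Equiv.ofBijective _ hbij), ← Finset.card_compl,
    Nat.card_coe_set_eq, ← Set.ncard_coe_finset]
  congr 1
  ext v
  simp

lemma IsTough.indepNum_le [Fintype V] (hV : 3 ≤ Fintype.card V) (h : G.IsTough 1) :
    (G.indepNum : ℝ) ≤ (Fintype.card V : ℝ) / 2 := by
  classical
  obtain ⟨I, hI⟩ := G.exists_isNIndepSet_indepNum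
  rw [← hI.card_eq]
  by_contra! hcon
  have hcon : (Fintype.card V : ℝ) < 2 * I.card := by linarith
  have hcon : Fintype.card V < 2 * I.card := by exact_mod_cast hcon
  have hcompl := Finset.card_add_card_compl I
  have hnum : G.numComponentsDelete Iᶜ = I.card := by
    rw [numComponentsDelete_of_indep]
    · omega
    · intro a ha b hb hab
      rw [Finset.mem_compl, not_not] at ha hb
      exact hI.isIndepSet ha hb hab.ne hab
  have := h.mul_le Iᶜ (by omega)
  rw [hnum, one_mul] at this
  have : I.card ≤ Iᶜ.card := by exact_mod_cast this
  omega

/-- Suppose ω(G - S) > |S|; connectivity gives |S| ≥ k. If G - S has an edge, one vertex from each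
other component gives at least k independent vertices missing it. If not, G - S is an independent
set of more than half the order. -/
lemma isTough_one_of_indepNum_le [Fintype V] (hconn : G.IsKConnected k)
    (hfree : G.IsInducedFree (edgeUnionIsolated k))
    (hα : (G.indepNum : ℝ) ≤ (Fintype.card V : ℝ) / 2) : G.IsTough 1 := by
  classical
  refine isTough_one fun S hS => ?_
  by_contra! hlt
  have hkS : k ≤ S.card := by
    by_contra! hcon
    have hc := hconn.2 S hcon
    have := hc.preconnected.subsingleton_connectedComponent
    rw [numComponentsDelete, Nat.succ_le_iff, Finite.one_lt_card_iff_nontrivial] at hS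
    exact not_nontrivial _ hS
  by_cases hedge : ∃ a ∉ S, ∃ b ∉ S, G.Adj a b
  · obtain ⟨a, ha, b, hb, hab⟩ := hedge
    set H := G.induce {v | v ∉ S} with hH
    have : Fintype H.ConnectedComponent := Fintype.ofFinite _
    set C := (Finset.univ : Finset H.ConnectedComponent).erase (H.connectedComponentMk ⟨a, ha⟩)
      with hC
    let r : H.ConnectedComponent → V := fun c => (c.out : {v | v ∉ S}).1
    have hr : ∀ c, H.connectedComponentMk ⟨r c, (c.out : {v | v ∉ S}).2⟩ = c := fun c =>
      Quot.out_eq c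
    have hcard : C.card + 1 = G.numComponentsDelete S := by
      rw [hC, Finset.card_erase_add_one (Finset.mem_univ _), Finset.card_univ, numComponentsDelete,
        Nat.card_eq_fintype_card]
    have hadj : ∀ u (hu : u ∉ S) c, G.Adj u (r c) → H.connectedComponentMk ⟨u, hu⟩ = c := by
      intro u hu c huc
      rw [← hr c]
      refine ConnectedComponent.sound (Adj.reachable ?_)
      simpa [hH] using huc
    have hinj : Function.Injective r := by
      intro c d hcd
      rw [← hr c, ← hr d]
      congr 1
      exact Subtype.ext hcd
    have hb' : H.connectedComponentMk ⟨b, hb⟩ = H.connectedComponentMk ⟨a, ha⟩ :=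
      ConnectedComponent.sound (Adj.reachable (by simpa [hH] using hab.symm))
    have := hfree.card_lt hab (S := C.image r) ?_ ?_
    · rw [Finset.card_image_of_injective _ hinj] at this
      omega
    · intro u hu v hv huv
      obtain ⟨c, -, rfl⟩ := Finset.mem_image.1 hu
      obtain ⟨d, -, rfl⟩ := Finset.mem_image.1 hv
      have h1 := hadj _ (c.out : {v | v ∉ S}).2 d huv
      rw [hr c] at h1
      subst h1
      exact huv.ne rfl
    · intro u hu
      obtain ⟨c, hc, rfl⟩ := Finset.mem_image.1 hu
      have hne := Finset.ne_of_mem_erase hc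
      exact ⟨fun h' => hne (hadj a ha c h').symm, fun h' => hne ((hadj b hb c h').symm.trans hb')⟩
  · push Not at hedge
    have h1 := numComponentsDelete_of_indep hedge
    have h2 := two_mul_card_le hα Sᶜ fun a ha b hb =>
      hedge a (Finset.mem_compl.1 ha) b (Finset.mem_compl.1 hb)
    have := Finset.card_add_card_compl S
    omega

lemma IsKConnected.mono [Fintype V] {l : ℕ} (h : G.IsKConnected l) (hkl : k ≤ l) :
    G.IsKConnected k :=
  ⟨hkl.trans_lt h.1, fun X hX => h.2 X (hX.trans_le hkl)⟩

lemma IsKConnected.le_degree [Fintype V] [DecidableRel G.Adj] (h : G.IsKConnected k) (v : V) :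
    k ≤ G.degree v := by
  classical
  by_contra! hlt
  have hc := h.2 (G.neighborFinset v) (by rwa [card_neighborFinset_eq_degree])
  obtain ⟨w, hw⟩ : ∃ w, w ∉ insert v (G.neighborFinset v) := by
    by_contra! hcon
    have h1 := Finset.card_le_card (fun w _ => hcon w : Finset.univ ⊆ _)
    have h2 := Finset.card_insert_le v (G.neighborFinset v)
    have := h.1
    rw [card_neighborFinset_eq_degree] at h2
    rw [Finset.card_univ] at h1
    omega
  rw [Finset.mem_insert, not_or] at hw
  have hv : v ∉ G.neighborFinset v := by simp
  obtain ⟨p⟩ := hc.preconnected ⟨v, hv⟩ ⟨w, hw.2⟩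
  cases p with
  | nil => exact hw.1 rfl
  | @cons _ b _ hab q =>
    exact b.2 (by simpa using hab)

end SimpleGraph

theorem theorem1p4 {V : Type*} [Fintype V] [DecidableEq V] (G : SimpleGraph V)
    [DecidableRel G.Adj] :
    -- the main statement
    (∀ k : ℕ, 2 ≤ k → G.IsKConnected k →
      G.IsInducedFree (SimpleGraph.edgeUnionIsolated k) →
      3 * ((k : ℝ) - 1) / 2 ≤ (G.minDegree : ℝ) →
      (G.indepNum : ℝ) ≤ (Fintype.card V : ℝ) / 2 →
        G.IsHamiltonian ∨ Nonempty (G ≃g SimpleGraph.petersenGraph)) ∧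
    -- the independence number condition is equivalent to being 1-tough
    (∀ k : ℕ, 2 ≤ k → G.IsKConnected k →
      G.IsInducedFree (SimpleGraph.edgeUnionIsolated k) →
        ((G.indepNum : ℝ) ≤ (Fintype.card V : ℝ) / 2 ↔ G.IsTough 1)) ∧
    -- the Shi–Shan conjecture
    (∀ k : ℕ, 4 ≤ k → G.IsTough 1 → G.IsKConnected (2 * k) →
      G.IsInducedFree (SimpleGraph.edgeUnionIsolated k) → G.IsHamiltonian) ∧
    -- the earlier result for `k = 2`
    (3 ≤ Fintype.card V → G.IsTough 1 →
      G.IsInducedFree (SimpleGraph.edgeUnionIsolated 2) → G.IsHamiltonian) ∧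
    -- the earlier result for `k = 3`
    (3 ≤ Fintype.card V → G.IsTough 3 →
      G.IsInducedFree (SimpleGraph.edgeUnionIsolated 3) → G.IsHamiltonian) := by
  have htwo : 3 ≤ Fintype.card V → G.IsTough 1 →
      G.IsInducedFree (SimpleGraph.edgeUnionIsolated 2) → G.IsHamiltonian := by
    intro hV ht hfree
    have hconn : G.IsKConnected 2 := ht.isKConnected hV (by norm_num)
    have := SimpleGraph.isHamiltonian_or_petersen le_rfl hconn hfree
      (fun v => by have := hconn.le_degree v; omega)
      (SimpleGraph.two_mul_card_le (ht.indepNum_le hV))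
    simpa using this
  refine ⟨fun k hk hconn hfree hd hα => ?_, fun k hk hconn hfree => ?_,
    fun k hk ht hconn hfree => ?_, htwo, fun hV ht hfree => ?_⟩
  · refine (SimpleGraph.isHamiltonian_or_petersen hk hconn hfree (fun v => ?_)
      (SimpleGraph.two_mul_card_le hα)).imp_right fun h => h.2.2
    have h1 : (G.minDegree : ℝ) ≤ G.degree v := by exact_mod_cast G.minDegree_le_degree v
    obtain ⟨m, rfl⟩ : ∃ m, k = m + 1 := ⟨k - 1, by omega⟩
    push_cast at hd
    have : (3 * m : ℝ) ≤ 2 * G.degree v := by linarith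
    rw [Nat.add_sub_cancel]
    exact_mod_cast this
  · exact ⟨SimpleGraph.isTough_one_of_indepNum_le hconn hfree,
      fun ht => ht.indepNum_le (by have := hconn.1; omega)⟩
  -- The connectivity 2k is used for the degree bound; otherwise k suffices. The Petersen outcome
  -- needs k = 3.
  · have := SimpleGraph.isHamiltonian_or_petersen (by omega) (hconn.mono (by omega)) hfree
      (fun v => by have := hconn.le_degree v; omega)
      (SimpleGraph.two_mul_card_le (ht.indepNum_le (by have := hconn.1; omega)))
    exact this.resolve_right fun h => by omega
  · have ht1 : G.IsTough 1 := le_trans (by norm_num) ht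
    rcases hV.lt_or_eq with hV' | hV'
    · have hconn : G.IsKConnected 3 := ht.isKConnected hV' (by norm_num)
      rcases SimpleGraph.isHamiltonian_or_petersen (by omega) hconn hfree
        (fun v => by have := hconn.le_degree v; omega)
        (SimpleGraph.two_mul_card_le (ht1.indepNum_le hV)) with h | ⟨-, ⟨x, hx⟩, ⟨e⟩⟩
      · exact h
      · exfalso
        have hcard : Fintype.card V = 10 := by
          rw [Fintype.card_congr e.toEquiv]; rfl
        -- A 3-tough graph on ten vertices is 6-connected, so it has no vertex of degree 3.
        have hconn6 : G.IsKConnected 6 := ht.isKConnected (by omega) (by norm_num)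
        have := hconn6.le_degree x
        omega
    -- On three vertices 3-connectivity fails, but K₂ ∪ 2K₁ has four vertices and so cannot occur.
    · refine htwo hV ht1 ?_
      rintro ⟨φ⟩
      have := Fintype.card_le_of_injective φ φ.injective
      simp at this
      omega
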